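/- Let $G=(V,E)$ be a finite simple graph on $n$ vertices, let $a\neq b$ be two vertices, and let $G'$ be obtained from $G$ by inserting the edge $\{a,b\}$ (if it is absent) or deleting it (if it is present). Given a ranking $\pi:V\to[0,1]$, the lexicographically first maximal independent set $\mathrm{LFMIS}(G,\pi)$ is built greedily: all vertices start alive; repeatedly, the alive vertex of lowest rank (ties broken by a fixed total order on $V$) joins the set, and it and its alive neighbors are killed. The eliminator $\mathrm{elim}_{G,\pi}(v)$ is the lowest-rank vertex of $\mathrm{LFMIS}(G,\pi)$ in the closed neighborhood $N_G(v)\cup\{v\}$. Let $A_\pi(G,G')=\{v\in V:\mathrm{elim}_{G,\pi}(v)\neq \mathrm{elim}_{G',\pi}(v)\}$. Lemma. If $\pi$ is a random ranking, then for every $\lambda\in[0,1]$, $$\mathbb E_\pi\big[\,|A_\pi(G,G')|\;\big|\;\min\{\pi(a),\pi(b)\}=\lambda\,\big]\le O(\log n).$$ Precisely, there are absolute constants $C$ and $c$ such that, for all $V,G,G',a,b$ as above (with any fixed total order on $V$) and every $\lambda\in[0,1]$, the conditional expectation is at most $C\log n$ in both of the following models. (1) The ranks $\pi(v)$, $v\in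 V$, are independent and uniform on $[0,1]$. Here the conditional law of $\pi$ given $\min\{\pi(a),\pi(b)\}=\lambda$ is the following version: with probability $1/2$ each, one of $a,b$ has rank $\lambda$ and the other has a rank uniform on $[\lambda,1]$ (equal to $1$ if $\lambda=1$), while the other vertices have ranks uniform on $[0,1]$, all independent. (2) The ranks are independent and uniform on the $k$-bit fractions $\{j/2^k:0\le j<2^k\}$, for any integer $k\ge c\log_2 n$, and $\lambda$ is any value that $\min\{\pi(a),\pi(b)\}$ can take. -/

import Mathlib

open MeasureTheory
open scoped ENNReal BigOperators

noncomputable section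

namespace RandomGreedyMIS

/-! ### Lexicographically first maximal independent set and eliminators -/

section Greedy

variable {V : Type*} [LinearOrder V]

/-- Vertices are compared by rank; the (fixed) order on `V`, i.e. the order of the identifiers,
only matters between vertices of equal rank. -/
def key (π : V → ℝ) (v : V) : ℝ ×ₗ V := toLex (π v, v)

/-- The vertex of lowest rank in a nonempty finite set. -/
def lowest (π : V → ℝ) (s : Finset V) (hs : s.Nonempty) : V :=
  (ofLex ((s.image (key π)).min' (hs.image _))).2

theorem lowest_mem (π : V → ℝ) (s : Finset V) (hs : s.Nonempty) : lowest π s hs ∈ s := by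
  obtain ⟨v, hv, h⟩ := Finset.mem_image.1 ((s.image (key π)).min'_mem (hs.image _))
  unfold lowest
  rw [← h]
  exact hv

theorem key_lowest_le (π : V → ℝ) (s : Finset V) (hs : s.Nonempty) {v : V} (hv : v ∈ s) :
    key π (lowest π s hs) ≤ key π v := by
  obtain ⟨u, hu, h⟩ := Finset.mem_image.1 ((s.image (key π)).min'_mem (hs.image _))
  have h1 : lowest π s hs = u := by
    unfold lowest
    rw [← h]
    rfl
  rw [h1, h]
  exact Finset.min'_le _ _ (Finset.mem_image_of_mem _ hv)

open scoped Classical in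
/-- The vertices of `alive` that survive when `v` joins the independent set and kills itself and
its neighbors. -/
def survivors (G : SimpleGraph V) (alive : Finset V) (v : V) : Finset V :=
  alive.filter fun w => w ≠ v ∧ ¬ G.Adj v w

theorem card_survivors_lt (G : SimpleGraph V) {alive : Finset V} {v : V} (hv : v ∈ alive) :
    (survivors G alive v).card < alive.card := by
  classical
  apply Finset.card_lt_card
  refine ⟨Finset.filter_subset _ _, fun h => ?_⟩
  have := h hv
  simp [survivors] at this

/-- The greedy process started from a set of alive vertices: take the alive vertex of lowest rank,
let it join the independent set, kill it and its alive neighbors, and repeat. -/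
def greedy (G : SimpleGraph V) (π : V → ℝ) (alive : Finset V) : Finset V :=
  if h : alive.Nonempty then
    insert (lowest π alive h) (greedy G π (survivors G alive (lowest π alive h)))
  else ∅
termination_by alive.card
decreasing_by
  exact card_survivors_lt G (lowest_mem π alive h)

/-- The lexicographically first maximal independent set of `G` with respect to the ranking `π`. -/
def lfmis [Fintype V] (G : SimpleGraph V) (π : V → ℝ) : Finset V := greedy G π Finset.univ

theorem exists_mem_greedy (G : SimpleGraph V) (π : V → ℝ) (alive : Finset V) :
    ∀ v ∈ alive, ∃ u ∈ greedy G π alive, u = v ∨ G.Adj v u := by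
  induction alive using greedy.induct G π with
  | case1 alive h ih =>
    intro v hv
    rw [greedy, dif_pos h]
    by_cases h1 : v = lowest π alive h
    · exact ⟨_, Finset.mem_insert_self _ _, Or.inl h1.symm⟩
    by_cases h2 : G.Adj (lowest π alive h) v
    · exact ⟨_, Finset.mem_insert_self _ _, Or.inr h2.symm⟩
    obtain ⟨u, hu, h3⟩ := ih v (by simp [survivors, hv, h1, h2])
    exact ⟨u, Finset.mem_insert_of_mem hu, h3⟩
  | case2 alive h =>
    intro v hv
    exact absurd ⟨v, hv⟩ h

open scoped Classical in
/-- The members of the lexicographically first maximal independent set in the closed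
neighborhood of `v`. -/
def dominators [Fintype V] (G : SimpleGraph V) (π : V → ℝ) (v : V) : Finset V :=
  (lfmis G π).filter fun u => u = v ∨ G.Adj v u

theorem dominators_nonempty [Fintype V] (G : SimpleGraph V) (π : V → ℝ) (v : V) :
    (dominators G π v).Nonempty := by
  obtain ⟨u, hu, h⟩ := exists_mem_greedy G π Finset.univ v (Finset.mem_univ v)
  exact ⟨u, by simp only [dominators, lfmis, Finset.mem_filter]; exact ⟨hu, h⟩⟩

/-- The eliminator of `v`: the lowest-rank vertex of the closed neighborhood of `v` that belongs
to the lexicographically first maximal independent set. -/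
def eliminator [Fintype V] (G : SimpleGraph V) (π : V → ℝ) (v : V) : V :=
  lowest π (dominators G π v) (dominators_nonempty G π v)

/-- The vertices whose eliminators in `G` and `G'` differ. -/
def affected [Fintype V] (G G' : SimpleGraph V) (π : V → ℝ) : Finset V :=
  Finset.univ.filter fun v => eliminator G π v ≠ eliminator G' π v

end Greedy

/-- `G'` is `G` with the edge `{a, b}` inserted (if absent) or deleted (if present). -/
def IsEdgeUpdate {V : Type*} (G G' : SimpleGraph V) (a b : V) : Prop :=
  (¬ G.Adj a b ∧ G' = G ⊔ SimpleGraph.edge a b) ∨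
    (G.Adj a b ∧ G' = G.deleteEdges {s(a, b)})

/-! ### Random rankings with real entries, and their conditional law -/

section Real

variable {V : Type*} [DecidableEq V]

/-- The uniform distribution on `[0, 1]`. -/
def unif : Measure ℝ := volume.restrict (Set.Icc 0 1)

/-- The law of a random ranking: independent entries, uniform on `[0, 1]`. -/
def rankLaw (V : Type*) [Fintype V] : Measure (V → ℝ) := Measure.pi fun _ => unif

/-- Give `a` the rank `lam` and rescale the rank of `b` from `[0, 1]` to `[lam, 1]`. -/
def pin (a b : V) (lam : ℝ) (ρ : V → ℝ) : V → ℝ :=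
  Function.update (Function.update ρ a lam) b (lam + (1 - lam) * ρ b)

/-- The law of a random ranking `π` conditioned on `min (π a) (π b) = lam`: with probability `1/2`
each, one of `a`, `b` has rank `lam` and the other one has a uniform rank in `[lam, 1]`; the
remaining ranks are uniform in `[0, 1]`, and all is independent. That this is indeed the
conditional law is the theorem `lintegral_rankLaw_eq` below. -/
def condRankLaw [Fintype V] (a b : V) (lam : ℝ) : Measure (V → ℝ) :=
  (2⁻¹ : ℝ≥0∞) • (rankLaw V).map (pin a b lam) + (2⁻¹ : ℝ≥0∞) • (rankLaw V).map (pin b a lam)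

instance : IsProbabilityMeasure unif := ⟨by simp [unif]⟩

instance [Fintype V] : IsProbabilityMeasure (rankLaw V) := by unfold rankLaw; infer_instance

theorem measurable_pin (a b : V) (lam : ℝ) : Measurable (pin a b lam) := by
  rw [measurable_pi_iff]
  intro i
  unfold pin
  by_cases h : i = b
  · subst h
    simp only [Function.update_self]
    fun_prop
  · by_cases h' : i = a
    · subst h'
      simp [Function.update_of_ne h]
    · simp only [Function.update_of_ne h, Function.update_of_ne h']
      fun_prop

instance [Fintype V] (a b : V) (lam : ℝ) : IsProbabilityMeasure (condRankLaw a b lam) := by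
  constructor
  simp [condRankLaw, Measure.map_apply (measurable_pin _ _ _), ENNReal.inv_two_add_inv_two]

theorem measurable_update_pair (a : V) :
    Measurable fun p : (V → ℝ) × ℝ => Function.update p.1 a p.2 := by
  rw [measurable_pi_iff]
  intro i
  by_cases h : i = a
  · subst h
    simp only [Function.update_self]
    fun_prop
  · simp only [Function.update_of_ne h]
    fun_prop

theorem lintegral_update [Fintype V] (a : V) (f : (V → ℝ) → ℝ≥0∞) (hf : Measurable f) :
    ∫⁻ ρ, ∫⁻ x, f (Function.update ρ a x) ∂unif ∂rankLaw V = ∫⁻ ρ, f ρ ∂rankLaw V := by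
  have hm := measurable_update_pair a
  have hmap : ((rankLaw V).prod unif).map (fun p : (V → ℝ) × ℝ => Function.update p.1 a p.2) =
      rankLaw V := by
    refine (Measure.pi_eq fun s hs => ?_).symm
    rw [Measure.map_apply hm (MeasurableSet.univ_pi hs)]
    have hpre : (fun p : (V → ℝ) × ℝ => Function.update p.1 a p.2) ⁻¹' Set.univ.pi s =
        (Set.univ.pi (Function.update s a Set.univ)) ×ˢ s a := by
      ext ⟨ρ, x⟩
      simp only [Set.mem_preimage, Set.mem_pi, Set.mem_univ, true_imp_iff, Set.mem_prod]
      constructor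
      · intro h
        refine ⟨fun i => ?_, by simpa using h a⟩
        by_cases hi : i = a
        · subst hi
          simp
        · simpa [Function.update_of_ne hi] using h i
      · rintro ⟨h1, h2⟩ i
        by_cases hi : i = a
        · subst hi
          simpa using h2
        · simpa [Function.update_of_ne hi] using h1 i
    rw [hpre, Measure.prod_prod, rankLaw, Measure.pi_pi,
      ← Finset.mul_prod_erase _ _ (Finset.mem_univ a),
      ← Finset.mul_prod_erase _ (fun i => unif (s i)) (Finset.mem_univ a)]
    have : ∏ x ∈ Finset.univ.erase a, unif (Function.update s a Set.univ x) =
        ∏ x ∈ Finset.univ.erase a, unif (s x) :=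
      Finset.prod_congr rfl fun i hi => by rw [Function.update_of_ne (Finset.ne_of_mem_erase hi)]
    rw [this]
    simp [mul_comm]
  conv_rhs => rw [← hmap]
  rw [lintegral_map hf hm]
  exact (lintegral_prod _ (hf.comp hm).aemeasurable).symm

theorem lintegral_rescale (x : ℝ) (hx : x ≤ 1) (f : ℝ → ℝ≥0∞) (hf : Measurable f) :
    ∫⁻ y in Set.Icc x 1, f y = ENNReal.ofReal (1 - x) * ∫⁻ t, f (x + (1 - x) * t) ∂unif := by
  rcases hx.eq_or_lt with rfl | hx
  · simp
  have h0 : 0 < 1 - x := by linarith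
  have key : ∫⁻ t, (Set.Icc x 1).indicator f (x + (1 - x) * t) =
      ENNReal.ofReal ((1 - x)⁻¹) * ∫⁻ y, (Set.Icc x 1).indicator f y := by
    have hg : Measurable ((Set.Icc x 1).indicator f) := hf.indicator measurableSet_Icc
    have h1 := lintegral_map (μ := volume) (f := fun y => (Set.Icc x 1).indicator f (x + y))
      (by fun_prop) (measurable_const_mul (1 - x))
    rw [← h1, Real.map_volume_mul_left h0.ne', lintegral_smul_measure,
      lintegral_add_left_eq_self, abs_of_pos (inv_pos.2 h0), smul_eq_mul]
  have h2 : ∫⁻ t, f (x + (1 - x) * t) ∂unif =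
      ∫⁻ t, (Set.Icc x 1).indicator f (x + (1 - x) * t) := by
    rw [unif, ← lintegral_indicator measurableSet_Icc]
    congr 1 with t
    have : t ∈ Set.Icc (0 : ℝ) 1 ↔ x + (1 - x) * t ∈ Set.Icc x 1 := by
      constructor
      · rintro ⟨h, h'⟩
        constructor <;> nlinarith
      · rintro ⟨h, h'⟩
        constructor
        · by_contra! hc
          nlinarith
        · by_contra! hc
          nlinarith
    by_cases ht : t ∈ Set.Icc (0 : ℝ) 1
    · rw [Set.indicator_of_mem ht, Set.indicator_of_mem (this.1 ht)]
    · rw [Set.indicator_of_notMem ht, Set.indicator_of_notMem (fun h => ht (this.2 h))]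
  rw [h2, key, ← mul_assoc, ← ENNReal.ofReal_mul h0.le, mul_inv_cancel₀ h0.ne',
    ENNReal.ofReal_one, one_mul, lintegral_indicator measurableSet_Icc]

theorem measurable_update_update (a b : V) :
    Measurable fun p : (V → ℝ) × ℝ × ℝ =>
      Function.update (Function.update p.1 a p.2.1) b p.2.2 := by
  rw [measurable_pi_iff]
  intro i
  by_cases h : i = b
  · subst h
    simp only [Function.update_self]
    fun_prop
  · by_cases h' : i = a
    · subst h'
      simp only [Function.update_of_ne h, Function.update_self]
      fun_prop
    · simp only [Function.update_of_ne h, Function.update_of_ne h']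
      fun_prop

theorem measurable_pin_uncurry (a b : V) :
    Measurable fun p : ℝ × (V → ℝ) => pin a b p.1 p.2 :=
  (measurable_update_update a b).comp
    (g := fun p : (V → ℝ) × ℝ × ℝ => Function.update (Function.update p.1 a p.2.1) b p.2.2)
    (f := fun p : ℝ × (V → ℝ) => (p.2, p.1, p.1 + (1 - p.1) * p.2 b)) (by fun_prop)

theorem lintegral_pin [Fintype V] {a b : V} (hab : a ≠ b) {x : ℝ} (hx : x ≤ 1)
    (f : (V → ℝ) → ℝ≥0∞) (hf : Measurable f) :
    ∫⁻ y in Set.Icc x 1, ∫⁻ ρ, f (Function.update (Function.update ρ a x) b y) ∂rankLaw V =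
      ENNReal.ofReal (1 - x) * ∫⁻ ρ, f (pin a b x ρ) ∂rankLaw V := by
  have hm := hf.comp (measurable_update_update a b)
  rw [lintegral_rescale x hx]
  · congr 1
    rw [lintegral_lintegral_swap, ← lintegral_update b (fun ρ => f (pin a b x ρ))]
    · congr 1 with ρ
      congr 1 with t
      congr 1
      ext i
      by_cases h : i = b
      · subst h
        simp [pin]
      · by_cases h' : i = a
        · subst h'
          simp [pin, h]
        · simp [pin, h, h']
    · exact hf.comp (measurable_pin a b x)
    · exact (hm.comp (f := fun p : ℝ × (V → ℝ) => (p.2, x, x + (1 - x) * p.1))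
        (by fun_prop)).aemeasurable
  · exact (hm.comp (f := fun p : ℝ × (V → ℝ) => (p.2, x, p.1))
        (by fun_prop)).lintegral_prod_right'

theorem ae_unif_mem : ∀ᵐ x ∂unif, x ∈ Set.Icc (0 : ℝ) 1 := ae_restrict_mem measurableSet_Icc

theorem lintegral_unif_le {x : ℝ} (hx : x ∈ Set.Icc (0 : ℝ) 1) (w : ℝ → ℝ≥0∞) :
    ∫⁻ y, (Set.Ici x).indicator w y ∂unif = ∫⁻ y in Set.Icc x 1, w y := by
  rw [lintegral_indicator measurableSet_Ici, unif, Measure.restrict_restrict measurableSet_Ici]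
  congr 2
  ext y
  simp only [Set.mem_inter_iff, Set.mem_Ici, Set.mem_Icc]
  exact ⟨fun h => ⟨h.1, h.2.2⟩, fun h => ⟨h.1, hx.1.trans h.1, h.2⟩⟩

theorem lintegral_unif_lt {x : ℝ} (hx : x ∈ Set.Icc (0 : ℝ) 1) (w : ℝ → ℝ≥0∞) :
    ∫⁻ y, (Set.Ioi x).indicator w y ∂unif = ∫⁻ y in Set.Icc x 1, w y := by
  rw [lintegral_indicator measurableSet_Ioi, unif, Measure.restrict_restrict measurableSet_Ioi,
    ← Measure.restrict_congr_set Ioc_ae_eq_Icc]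
  congr 2
  ext y
  simp only [Set.mem_inter_iff, Set.mem_Ioi, Set.mem_Icc, Set.mem_Ioc]
  exact ⟨fun h => ⟨h.1, h.2.2⟩, fun h => ⟨h.1, hx.1.trans h.1.le, h.2⟩⟩

theorem lintegral_condRankLaw [Fintype V] (a b : V) (lam : ℝ) (f : (V → ℝ) → ℝ≥0∞)
    (hf : Measurable f) :
    ∫⁻ π, f π ∂condRankLaw a b lam = 2⁻¹ * ∫⁻ ρ, f (pin a b lam ρ) ∂rankLaw V +
      2⁻¹ * ∫⁻ ρ, f (pin b a lam ρ) ∂rankLaw V := by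
  rw [condRankLaw, lintegral_add_measure, lintegral_smul_measure, lintegral_smul_measure,
    lintegral_map hf (measurable_pin _ _ _), lintegral_map hf (measurable_pin _ _ _)]
  rfl

theorem lintegral_rankLaw_density [Fintype V] {a b : V} (hab : a ≠ b)
    (F : ℝ × (V → ℝ) → ℝ≥0∞) (hF : Measurable F) :
    ∫⁻ π, F (min (π a) (π b), π) ∂rankLaw V =
      ∫⁻ lam, ENNReal.ofReal (1 - lam) * (2 * ∫⁻ π, F (lam, π) ∂condRankLaw a b lam) ∂unif := by
  have hFx : ∀ x, Measurable fun π => F (x, π) := fun x => hF.comp (by fun_prop)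
  have hu := measurable_update_update a b
  -- the contribution of the event that `a` has the smaller rank, and that of its complement
  set W1 : ℝ × ℝ → ℝ≥0∞ := fun p =>
    ∫⁻ ρ, F (p.1, Function.update (Function.update ρ a p.1) b p.2) ∂rankLaw V with hW1
  set W2 : ℝ × ℝ → ℝ≥0∞ := fun p =>
    ∫⁻ ρ, F (p.2, Function.update (Function.update ρ a p.1) b p.2) ∂rankLaw V with hW2
  have mW1 : Measurable W1 :=
    (hF.comp (f := fun q : (ℝ × ℝ) × (V → ℝ) =>
      (q.1.1, Function.update (Function.update q.2 a q.1.1) b q.1.2))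
      (Measurable.prodMk (by fun_prop)
        (hu.comp (f := fun q : (ℝ × ℝ) × (V → ℝ) => (q.2, q.1.1, q.1.2))
          (by fun_prop)))).lintegral_prod_right'
  have mW2 : Measurable W2 :=
    (hF.comp (f := fun q : (ℝ × ℝ) × (V → ℝ) =>
      (q.1.2, Function.update (Function.update q.2 a q.1.1) b q.1.2))
      (Measurable.prodMk (by fun_prop)
        (hu.comp (f := fun q : (ℝ × ℝ) × (V → ℝ) => (q.2, q.1.1, q.1.2))
          (by fun_prop)))).lintegral_prod_right'
  have hle : MeasurableSet {p : ℝ × ℝ | p.1 ≤ p.2} := measurableSet_le measurable_fst measurable_snd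
  have hlt : MeasurableSet {p : ℝ × ℝ | p.2 < p.1} := measurableSet_lt measurable_snd measurable_fst
  have hf : Measurable fun π : V → ℝ => F (min (π a) (π b), π) := hF.comp (by fun_prop)
  have h1 : ∫⁻ π, F (min (π a) (π b), π) ∂rankLaw V =
      ∫⁻ x, ∫⁻ y, ({p : ℝ × ℝ | p.1 ≤ p.2}.indicator W1 (x, y) +
        {p : ℝ × ℝ | p.2 < p.1}.indicator W2 (x, y)) ∂unif ∂unif := by
    have hb : Measurable fun ρ : V → ℝ =>
        ∫⁻ y, F (min (Function.update ρ b y a) (Function.update ρ b y b),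
          Function.update ρ b y) ∂unif :=
      (hf.comp (measurable_update_pair b)).lintegral_prod_right'
    rw [← lintegral_update b _ hf, ← lintegral_update a _ hb]
    have hsw : Measurable fun q : (V → ℝ) × ℝ => ∫⁻ y,
        F (min (Function.update (Function.update q.1 a q.2) b y a)
          (Function.update (Function.update q.1 a q.2) b y b),
          Function.update (Function.update q.1 a q.2) b y) ∂unif :=
      hb.comp (measurable_update_pair a)
    rw [lintegral_lintegral_swap hsw.aemeasurable]
    congr 1 with x
    rw [lintegral_lintegral_swap (f := fun (ρ : V → ℝ) (y : ℝ) =>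
      F (min (Function.update (Function.update ρ a x) b y a)
          (Function.update (Function.update ρ a x) b y b),
          Function.update (Function.update ρ a x) b y)) (((hf.comp hu).comp
      (f := fun q : (V → ℝ) × ℝ => (q.1, x, q.2)) (by fun_prop)).aemeasurable)]
    congr 1 with y
    by_cases hxy : x ≤ y
    · simp [Set.indicator, hxy, hxy.not_gt, hW1, hab]
    · simp [Set.indicator, hxy, not_le.1 hxy, (not_le.1 hxy).le, hW2, hab]
  have m1 := mW1.indicator hle
  have m2 := mW2.indicator hlt
  have h2 : ∀ x, ∫⁻ y, ({p : ℝ × ℝ | p.1 ≤ p.2}.indicator W1 (x, y) +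
        {p : ℝ × ℝ | p.2 < p.1}.indicator W2 (x, y)) ∂unif =
      ∫⁻ y, {p : ℝ × ℝ | p.1 ≤ p.2}.indicator W1 (x, y) ∂unif +
        ∫⁻ y, {p : ℝ × ℝ | p.2 < p.1}.indicator W2 (x, y) ∂unif := fun x =>
    lintegral_add_left (m1.comp (by fun_prop)) _
  rw [h1]
  simp only [h2]
  rw [lintegral_add_left m1.lintegral_prod_right', lintegral_lintegral_swap (f := fun x y =>
    {p : ℝ × ℝ | p.2 < p.1}.indicator W2 (x, y)) m2.aemeasurable,
    ← lintegral_add_left m1.lintegral_prod_right']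
  refine lintegral_congr_ae ?_
  filter_upwards [ae_unif_mem] with x hx
  have e1 : ∫⁻ y, {p : ℝ × ℝ | p.1 ≤ p.2}.indicator W1 (x, y) ∂unif =
      ENNReal.ofReal (1 - x) * ∫⁻ ρ, F (x, pin a b x ρ) ∂rankLaw V := by
    rw [← lintegral_pin hab hx.2 (fun π => F (x, π)) (hFx x), ← lintegral_unif_le hx]
    rfl
  have e2 : ∫⁻ y, {p : ℝ × ℝ | p.2 < p.1}.indicator W2 (y, x) ∂unif =
      ENNReal.ofReal (1 - x) * ∫⁻ ρ, F (x, pin b a x ρ) ∂rankLaw V := by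
    rw [← lintegral_pin hab.symm hx.2 (fun π => F (x, π)) (hFx x), ← lintegral_unif_lt hx]
    congr 1 with y
    by_cases hxy : x < y
    · simp only [Set.indicator, Set.mem_ofPred_eq, Set.mem_Ioi, hxy, if_true, hW2]
      simp only [Function.update_comm hab]
    · simp [Set.indicator, hxy]
  rw [e1, e2, lintegral_condRankLaw a b x _ (hFx x), ← mul_add, ← mul_add, ← mul_assoc 2,
    ENNReal.mul_inv_cancel two_ne_zero ENNReal.ofNat_ne_top, one_mul]

/-- `condRankLaw a b` is a regular conditional distribution of a random ranking given the minimum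
of the ranks of `a` and `b`. -/
theorem lintegral_rankLaw_eq [Fintype V] {a b : V} (hab : a ≠ b)
    (F : ℝ × (V → ℝ) → ℝ≥0∞) (hF : Measurable F) :
    ∫⁻ π, F (min (π a) (π b), π) ∂rankLaw V =
      ∫⁻ lam, ∫⁻ π, F (lam, π) ∂condRankLaw a b lam
        ∂(rankLaw V).map fun π => min (π a) (π b) := by
  have hJ : Measurable fun lam => ∫⁻ π, F (lam, π) ∂condRankLaw a b lam := by
    have : ∀ c d : V, Measurable fun lam => ∫⁻ ρ, F (lam, pin c d lam ρ) ∂rankLaw V := fun c d =>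
      (hF.comp (measurable_fst.prodMk (measurable_pin_uncurry c d))).lintegral_prod_right'
    have h := ((this a b).const_mul 2⁻¹).add ((this b a).const_mul 2⁻¹)
    convert h using 2 with lam
    exact lintegral_condRankLaw a b lam _ (hF.comp (by fun_prop))
  rw [lintegral_map hJ (by fun_prop),
    lintegral_rankLaw_density hab
      (fun p => ∫⁻ π, F (p.1, π) ∂condRankLaw a b p.1) (hJ.comp measurable_fst),
    lintegral_rankLaw_density hab F hF]
  simp

end Real

/-! ### Random rankings with `k`-bit entries -/

/-- The ranking given by `k`-bit fractions `j / 2 ^ k`, `0 ≤ j < 2 ^ k`. -/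
def gridRank {V : Type*} {k : ℕ} (σ : V → Fin (2 ^ k)) (v : V) : ℝ := (σ v : ℕ) / 2 ^ k

open scoped Classical in
/-- The conditional expectation of `X π` given `min (π a) (π b) = lam`, where the entries of the
random ranking `π` are independent uniform `k`-bit fractions, i.e. the average of `X` over all
`k`-bit rankings that satisfy the condition (`0` if there is none). -/
def gridCondExp {V : Type*} [Fintype V] (k : ℕ) (a b : V) (lam : ℝ) (X : (V → ℝ) → ℝ) : ℝ :=
  𝔼 σ : V → Fin (2 ^ k) with min (gridRank σ a) (gridRank σ b) = lam, X (gridRank σ)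

end RandomGreedyMIS

end

/-! Let `a` be the earlier of the two endpoints. Until `a` is treated, the greedy processes on `G`
and `G'` coincide; treating `a` makes them differ at most in whether `b` is alive; afterwards `a` is
dead and the changed edge is irrelevant. What remains is one graph, two alive sets `P`, `Q` with
symmetric difference inside `{b}`, and a uniformly random order of the vertices still to come. A
vertex is alive exactly as long as its eliminator has not been treated, so a vertex that never
becomes a discrepancy (alive in exactly one process) has the same eliminator in both graphs. It
suffices to count discrepancies.

The count is controlled by the potential `∑ log (1 + d w)` over current discrepancies `w`, with `d
w` the number of neighbors of `w` alive in both processes. Treating a discrepancy `w` can create up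
to `d w` new ones. But a random vertex is as likely to be any one of the `d w` common neighbors, and
treating one of those removes `w`. Adding these effects to the loss of degree caused by the other
common vertices gives `sum_potential_step_le`: in expectation, new discrepancies plus new potential
do not exceed the old potential. Induction (`sum_card_discrepancies_le`) bounds the expected number
of discrepancies by `1 + log n`.

The random order comes from exchangeability: given the set `T` of vertices ranked above `lam`,
permuting the ranks inside `T` preserves the law, so one may first average over permutations of `T`
(`IsEdgeUpdate.sum_perm_le`). For `k`-bit ranks, the only ties treated exactly are those of `a` and
`b` as the two last vertices; the remaining ones have probability at most `n ^ 2 / 2 ^ k`, and they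
cost at most `n` each time. -/

noncomputable section

namespace RandomGreedyMIS

/-! ### Two greedy processes run in parallel -/

section Parallel

/-- This is the net drift caused by one discrepancy with `d` common neighbors. Bound each `log (1 +
e v)` by the tangent of `log` at `1 + d`; the slack left over is `d / (1 + d) ≤ log (1 + d)`. -/
theorem bracket_nonpos {ι : Type*} (s : Finset ι) (e : ι → ℕ) :
    (s.card : ℝ) + ∑ v ∈ s, Real.log (1 + (e v : ℝ)) ≤
      s.card * Real.log (1 + s.card) + (∑ v ∈ s, (e v : ℝ)) / (1 + s.card) +
        Real.log (1 + s.card) := by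
  set d := (s.card : ℝ) with hd
  have hd0 : 0 ≤ d := by positivity
  have hd1 : 0 < 1 + d := by positivity
  have h1 : ∀ v ∈ s, Real.log (1 + e v) ≤ Real.log (1 + d) + (1 + e v) / (1 + d) - 1 := by
    intro v _
    have he : (0 : ℝ) < 1 + e v := by positivity
    have := Real.log_le_sub_one_of_pos (div_pos he hd1)
    rw [Real.log_div he.ne' hd1.ne'] at this
    linarith
  have h2 := Finset.sum_le_sum h1
  have h3 : ∑ v ∈ s, (Real.log (1 + d) + (1 + (e v : ℝ)) / (1 + d) - 1) =
      d * Real.log (1 + d) + (d + ∑ v ∈ s, (e v : ℝ)) / (1 + d) - d := by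
    rw [Finset.sum_sub_distrib, Finset.sum_add_distrib, ← Finset.sum_div, Finset.sum_add_distrib]
    simp [hd]
  have h4 : d / (1 + d) ≤ Real.log (1 + d) := by
    have := Real.one_sub_inv_le_log_of_pos hd1
    have h5 : d / (1 + d) = 1 - (1 + d)⁻¹ := by field_simp; ring
    rw [h5]
    exact this
  rw [h3, add_div] at h2
  linarith

variable {V : Type*} [DecidableEq V]

/-- The alive vertices after the greedy process has treated `y`. -/
def step (G : SimpleGraph V) [DecidableRel G.Adj] (y : V) (P : Finset V) : Finset V :=
  if y ∈ P then P.filter fun w => w ≠ y ∧ ¬ G.Adj y w else P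

/-- Two greedy processes treat the vertices of a list, starting from the alive sets `P` and `Q`.
The vertices that are at some time alive in exactly one of the processes. -/
def discrepancies (G G' : SimpleGraph V) [DecidableRel G.Adj] [DecidableRel G'.Adj] :
    List V → Finset V → Finset V → Finset V
  | [], P, Q => symmDiff P Q
  | y :: l, P, Q => symmDiff P Q ∪ discrepancies G G' l (step G y P) (step G' y Q)

/-- The neighbors of `w` in `B`. -/
def nbrs (G : SimpleGraph V) [DecidableRel G.Adj] (B : Finset V) (w : V) : Finset V :=
  B.filter (G.Adj w)

/-- The potential of a pair of alive sets: every vertex alive in only one of them contributes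
`log (1 + d)`, where `d` is the number of its neighbors that are alive in both. -/
def potential (G : SimpleGraph V) [DecidableRel G.Adj] (P Q : Finset V) : ℝ :=
  ∑ w ∈ symmDiff P Q, Real.log (1 + (nbrs G (P ∩ Q) w).card)

variable (G G' : SimpleGraph V) [DecidableRel G.Adj] [DecidableRel G'.Adj]

theorem symmDiff_subset_discrepancies (l : List V) (P Q : Finset V) :
    symmDiff P Q ⊆ discrepancies G G' l P Q := by
  cases l with
  | nil => exact subset_rfl
  | cons y l => exact Finset.subset_union_left

theorem mem_step {y w : V} {P : Finset V} :
    w ∈ step G y P ↔ w ∈ P ∧ (y ∈ P → w ≠ y ∧ ¬ G.Adj y w) := by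
  unfold step
  split_ifs with h <;> simp [h]

theorem step_subset_erase {y : V} {P T : Finset V} (h : P ⊆ T) : step G y P ⊆ T.erase y := by
  intro w hw
  rw [mem_step] at hw
  rw [Finset.mem_erase]
  refine ⟨?_, h hw.1⟩
  rintro rfl
  exact (hw.2 hw.1).1 rfl

/-! ### The change of the potential in one step -/

theorem potential_nonneg (P Q : Finset V) : 0 ≤ potential G P Q :=
  Finset.sum_nonneg fun w _ => Real.log_nonneg (by simp)

theorem potential_comm (P Q : Finset V) : potential G P Q = potential G Q P := by
  unfold potential
  rw [symmDiff_comm, Finset.inter_comm]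

/-- This is `log x ≤ x - 1` for the ratio of the new to the old value of `1 + d`. The linear loss is
what can be summed over the treated vertex. -/
theorem log_card_nbrs_sdiff_le (B C : Finset V) (w : V) :
    Real.log (1 + ((nbrs G B w) \ C).card) ≤
      Real.log (1 + (nbrs G B w).card) - ((nbrs G B w) ∩ C).card / (1 + (nbrs G B w).card) := by
  have h := Finset.card_sdiff_add_card_inter (nbrs G B w) C
  set p := ((nbrs G B w) \ C).card
  set k := ((nbrs G B w) ∩ C).card
  rw [← h]
  push_cast
  have h1 : (0 : ℝ) < 1 + p := by positivity
  have h2 : (0 : ℝ) < 1 + (p + k) := by positivity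
  have := Real.log_le_sub_one_of_pos (div_pos h1 h2)
  rw [Real.log_div h1.ne' h2.ne'] at this
  have h5 : (k : ℝ) / (1 + (p + k)) = 1 - (1 + p) / (1 + (p + k)) := by field_simp; ring
  rw [h5]
  linarith

/-- Both sides count the edges between the neighborhood of `w` in `B` and the rest of `B`. -/
theorem sum_card_nbrs_inter (B : Finset V) (w : V) :
    ∑ y ∈ B \ nbrs G B w, (nbrs G B w ∩ nbrs G B y).card =
      ∑ v ∈ nbrs G B w, (nbrs G B v \ nbrs G B w).card := by
  have := Finset.sum_card_bipartiteAbove_eq_sum_card_bipartiteBelow G.Adj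
    (s := B \ nbrs G B w) (t := nbrs G B w)
  convert this using 2 with y hy v hv
  · congr 1
    ext v
    simp only [Finset.mem_inter, Finset.bipartiteAbove, Finset.mem_filter, nbrs]
    tauto
  · congr 1
    ext v
    simp only [Finset.mem_sdiff, Finset.bipartiteBelow, Finset.mem_filter, nbrs, G.adj_comm]
    tauto

/-- When `y` joins in both processes, discrepancies adjacent to `y` die and none appear. Any other
discrepancy `w` loses exactly the common neighbors it shares with `y`. -/
theorem step_of_mem {y : V} {P Q : Finset V} (h : y ∈ P ∩ Q) :
    potential G (step G y P) (step G y Q) ≤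
      ∑ w ∈ symmDiff P Q, (if y ∈ nbrs G (P ∩ Q) w then 0 else
        (Real.log (1 + (nbrs G (P ∩ Q) w).card) -
          (nbrs G (P ∩ Q) w ∩ nbrs G (P ∩ Q) y).card / (1 + (nbrs G (P ∩ Q) w).card))) := by
  have hP := (Finset.mem_inter.1 h).1
  have hQ := (Finset.mem_inter.1 h).2
  have hD : symmDiff (step G y P) (step G y Q) =
      (symmDiff P Q).filter fun w => ¬ y ∈ nbrs G (P ∩ Q) w := by
    ext w
    simp only [Finset.mem_symmDiff, mem_step, hP, hQ, true_imp_iff, nbrs, Finset.mem_filter, h,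
      true_and, G.adj_comm w y]
    by_cases hw : w = y
    · subst hw
      simp [hP, hQ]
    · tauto
  rw [potential, hD, Finset.sum_filter]
  refine Finset.sum_le_sum fun w hw => ?_
  by_cases hy : y ∈ nbrs G (P ∩ Q) w
  · simp [hy]
  · rw [if_pos hy, if_neg hy]
    refine le_trans (le_of_eq ?_) (log_card_nbrs_sdiff_le G (P ∩ Q) _ w)
    congr 4
    ext v
    simp only [nbrs, Finset.mem_filter, Finset.mem_inter, mem_step, hP, hQ, true_imp_iff,
      Finset.mem_sdiff]
    simp only [nbrs, Finset.mem_filter, Finset.mem_inter, hP, hQ, true_and] at hy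
    by_cases hv : v = y
    · subst hv
      tauto
    · tauto

/-- When `y` joins in only one process, it stops being a discrepancy, and only its common neighbors
can become new ones. They all leave the intersection, so a new discrepancy `v` keeps only the
neighbors outside the neighborhood of `y`. -/
theorem step_of_mem_left {y : V} {P Q : Finset V} (hP : y ∈ P) (hQ : y ∉ Q) :
    (symmDiff (step G y P) (step G y Q) \ symmDiff P Q).card +
        potential G (step G y P) (step G y Q) ≤
      potential G P Q - Real.log (1 + (nbrs G (P ∩ Q) y).card) + (nbrs G (P ∩ Q) y).card +
        ∑ v ∈ nbrs G (P ∩ Q) y,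
          Real.log (1 + (nbrs G (P ∩ Q) v \ nbrs G (P ∩ Q) y).card) := by
  have hyD : y ∈ symmDiff P Q := by simp [Finset.mem_symmDiff, hP, hQ]
  have hB : step G y P ∩ step G y Q = (P ∩ Q) \ nbrs G (P ∩ Q) y := by
    ext v
    simp only [nbrs, Finset.mem_filter, Finset.mem_inter, mem_step, hP, hQ, true_imp_iff,
      Finset.mem_sdiff, false_imp_iff, and_true]
    by_cases hv : v = y
    · subst hv
      tauto
    · tauto
  have hD : symmDiff (step G y P) (step G y Q) ⊆ (symmDiff P Q).erase y ∪ nbrs G (P ∩ Q) y := by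
    intro w
    simp only [Finset.mem_symmDiff, mem_step, hP, hQ, true_imp_iff, nbrs, Finset.mem_filter,
      false_imp_iff, and_true, Finset.mem_union, Finset.mem_erase, Finset.mem_inter]
    by_cases hw : w = y
    · subst hw
      simp [hQ]
    · tauto
  have hnn : ∀ C : Finset V, 0 ≤ Real.log (1 + (C.card : ℝ)) := fun C => Real.log_nonneg (by simp)
  have hmono : ∀ C C' : Finset V, C ⊆ C' →
      Real.log (1 + (C.card : ℝ)) ≤ Real.log (1 + (C'.card : ℝ)) := fun C C' h =>
    Real.log_le_log (by positivity) (by have := Finset.card_le_card h; gcongr)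
  have h1 : ((symmDiff (step G y P) (step G y Q) \ symmDiff P Q).card : ℝ) ≤
      (nbrs G (P ∩ Q) y).card := by
    norm_cast
    refine Finset.card_le_card fun w hw => ?_
    rw [Finset.mem_sdiff] at hw
    rcases Finset.mem_union.1 (hD hw.1) with h | h
    · exact absurd (Finset.mem_of_mem_erase h) hw.2
    · exact h
  have h2 : potential G (step G y P) (step G y Q) ≤
      ∑ w ∈ (symmDiff P Q).erase y, Real.log (1 + (nbrs G (P ∩ Q) w).card) +
        ∑ v ∈ nbrs G (P ∩ Q) y,
          Real.log (1 + (nbrs G (P ∩ Q) v \ nbrs G (P ∩ Q) y).card) := by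
    have e : ∀ v, nbrs G (step G y P ∩ step G y Q) v =
        nbrs G (P ∩ Q) v \ nbrs G (P ∩ Q) y := by
      intro v
      rw [hB]
      ext u
      simp only [nbrs, Finset.mem_filter, Finset.mem_sdiff]
      tauto
    unfold potential
    simp only [e]
    refine (Finset.sum_le_sum_of_subset_of_nonneg hD fun _ _ _ => hnn _).trans ?_
    refine (le_add_of_nonneg_right (Finset.sum_nonneg fun v _ => hnn _)).trans
      (Finset.sum_union_inter).le |>.trans ?_
    gcongr with w hw
    exact Finset.sdiff_subset
  have h3 := Finset.add_sum_erase _ (fun w => Real.log (1 + ((nbrs G (P ∩ Q) w).card : ℝ))) hyD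
  rw [show potential G P Q = _ from h3.symm]
  linarith

theorem step_of_mem_symmDiff {y : V} {P Q : Finset V} (h : y ∈ symmDiff P Q) :
    (symmDiff (step G y P) (step G y Q) \ symmDiff P Q).card +
        potential G (step G y P) (step G y Q) ≤
      potential G P Q - Real.log (1 + (nbrs G (P ∩ Q) y).card) + (nbrs G (P ∩ Q) y).card +
        ∑ v ∈ nbrs G (P ∩ Q) y,
          Real.log (1 + (nbrs G (P ∩ Q) v \ nbrs G (P ∩ Q) y).card) := by
  rcases Finset.mem_symmDiff.1 h with ⟨h1, h2⟩ | ⟨h1, h2⟩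
  · exact step_of_mem_left G h1 h2
  · have := step_of_mem_left G h1 h2
    rwa [potential_comm, potential_comm G Q P, Finset.inter_comm Q P, symmDiff_comm Q P,
      symmDiff_comm (step G y Q)] at this

/-- The potential, plus the number of new discrepancies, is a supermartingale. -/
theorem sum_potential_step_le {T P Q : Finset V} (hP : P ⊆ T) (hQ : Q ⊆ T) :
    ∑ y ∈ T, (((symmDiff (step G y P) (step G y Q) \ symmDiff P Q).card : ℝ) +
        potential G (step G y P) (step G y Q)) ≤ T.card * potential G P Q := by
  set B := P ∩ Q with hB
  set D := symmDiff P Q with hD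
  have hBT : B ⊆ T := Finset.inter_subset_left.trans hP
  have hDT : D ⊆ T \ B := by
    intro w
    simp only [hD, hB, Finset.mem_symmDiff, Finset.mem_sdiff, Finset.mem_inter]
    have := @hP w
    have := @hQ w
    tauto
  rw [← Finset.sum_sdiff hBT, ← Finset.sum_sdiff hDT]
  have c1 := Finset.card_sdiff_add_card_eq_card hBT
  have c2 := Finset.card_sdiff_add_card_eq_card hDT
  rw [← c1, ← c2]
  push_cast
  have hnn : ∀ C : Finset V, 0 ≤ Real.log (1 + (C.card : ℝ)) := fun C => Real.log_nonneg (by simp)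
  -- A vertex already dead in both processes changes nothing.
  have s1 : ∑ y ∈ (T \ B) \ D, (((symmDiff (step G y P) (step G y Q) \ D).card : ℝ) +
        potential G (step G y P) (step G y Q)) = ((T \ B) \ D).card * potential G P Q := by
    rw [← nsmul_eq_mul, ← Finset.sum_const]
    refine Finset.sum_congr rfl fun y hy => ?_
    have h1 : y ∉ P ∧ y ∉ Q := by
      simp only [hD, hB, Finset.mem_symmDiff, Finset.mem_sdiff, Finset.mem_inter] at hy
      tauto
    simp [step, h1.1, h1.2, ← hD]
  have s2 : ∑ y ∈ D, (((symmDiff (step G y P) (step G y Q) \ D).card : ℝ) +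
        potential G (step G y P) (step G y Q)) ≤
      D.card * potential G P Q + ∑ y ∈ D, ((nbrs G B y).card - Real.log (1 + (nbrs G B y).card) +
        ∑ v ∈ nbrs G B y, Real.log (1 + (nbrs G B v \ nbrs G B y).card)) := by
    rw [← nsmul_eq_mul, ← Finset.sum_const, ← Finset.sum_add_distrib]
    refine Finset.sum_le_sum fun y hy => ?_
    have := step_of_mem_symmDiff G hy
    linarith
  have s3 : ∑ y ∈ B, (((symmDiff (step G y P) (step G y Q) \ D).card : ℝ) +
        potential G (step G y P) (step G y Q)) ≤
      B.card * potential G P Q - ∑ w ∈ D, ((nbrs G B w).card * Real.log (1 + (nbrs G B w).card) +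
        (∑ v ∈ nbrs G B w, ((nbrs G B v \ nbrs G B w).card : ℝ)) / (1 + (nbrs G B w).card)) := by
    have h0 : ∀ y ∈ B, (((symmDiff (step G y P) (step G y Q) \ D).card : ℝ) +
        potential G (step G y P) (step G y Q)) ≤
        ∑ w ∈ D, (if y ∈ nbrs G B w then 0 else
        (Real.log (1 + (nbrs G B w).card) -
          (nbrs G B w ∩ nbrs G B y).card / (1 + (nbrs G B w).card))) := by
      intro y hy
      have h1 : symmDiff (step G y P) (step G y Q) \ D = ∅ := by
        rw [Finset.sdiff_eq_empty_iff_subset]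
        have hp := (Finset.mem_inter.1 hy).1
        have hq := (Finset.mem_inter.1 hy).2
        intro w
        simp only [hD, Finset.mem_symmDiff, mem_step, hp, hq, true_imp_iff]
        tauto
      rw [h1]
      simpa using step_of_mem G hy
    refine (Finset.sum_le_sum h0).trans (le_of_eq ?_)
    -- Regroup by the discrepancy `w`: its `d` common neighbors each remove its whole term, and the
    -- rest of `B` contributes the degree losses, which are double counted.
    rw [Finset.sum_comm, potential, Finset.mul_sum, ← Finset.sum_sub_distrib]
    refine Finset.sum_congr rfl fun w _ => ?_
    have hN : nbrs G B w ⊆ B := Finset.filter_subset _ _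
    rw [← Finset.sum_sdiff hN, Finset.sum_congr (g := fun _ => (0 : ℝ)) (s₁ := nbrs G B w) rfl
      fun y hy => if_pos hy, Finset.sum_const_zero, add_zero,
      Finset.sum_congr (s₁ := B \ nbrs G B w) rfl fun y hy => if_neg (Finset.mem_sdiff.1 hy).2,
      Finset.sum_sub_distrib, ← Finset.sum_div, Finset.sum_const, nsmul_eq_mul]
    have := sum_card_nbrs_inter G B w
    have h4 : (∑ y ∈ B \ nbrs G B w, ((nbrs G B w ∩ nbrs G B y).card : ℝ)) =
      ∑ v ∈ nbrs G B w, ((nbrs G B v \ nbrs G B w).card : ℝ) := by exact_mod_cast this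
    have h5 : ((B \ nbrs G B w).card : ℝ) = B.card - (nbrs G B w).card := by
      rw [eq_sub_iff_add_eq]
      exact_mod_cast Finset.card_sdiff_add_card_eq_card hN
    rw [h4, h5]
    ring
  -- The gains from treating `w` itself are paid for by the losses of the term of `w` when vertices
  -- of `B` are treated.
  have s4 : ∑ y ∈ D, ((nbrs G B y).card - Real.log (1 + (nbrs G B y).card) +
        ∑ v ∈ nbrs G B y, Real.log (1 + (nbrs G B v \ nbrs G B y).card)) ≤
      ∑ w ∈ D, ((nbrs G B w).card * Real.log (1 + (nbrs G B w).card) +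
        (∑ v ∈ nbrs G B w, ((nbrs G B v \ nbrs G B w).card : ℝ)) / (1 + (nbrs G B w).card)) := by
    refine Finset.sum_le_sum fun w _ => ?_
    have := bracket_nonpos (nbrs G B w) fun v => (nbrs G B v \ nbrs G B w).card
    linarith
  rw [s1]
  linarith

/-! ### The average over all orderings -/

/-- The lists of `m` different elements of `T`. -/
def orderings : ℕ → Finset V → Finset (List V)
  | 0, _ => {[]}
  | m + 1, T => T.biUnion fun y => (orderings m (T.erase y)).image (y :: ·)

theorem mem_orderings {m : ℕ} {T : Finset V} {l : List V} :
    l ∈ orderings m T ↔ l.Nodup ∧ l.length = m ∧ ∀ v ∈ l, v ∈ T := by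
  induction m generalizing T l with
  | zero =>
    simp only [orderings, Finset.mem_singleton, List.length_eq_zero_iff]
    constructor
    · rintro rfl
      simp
    · exact fun h => h.2.1
  | succ m ih =>
    simp only [orderings, Finset.mem_biUnion, Finset.mem_image, ih]
    constructor
    · rintro ⟨y, hy, l, ⟨h1, h2, h3⟩, rfl⟩
      refine ⟨List.nodup_cons.2 ⟨fun h => by simpa using h3 y h, h1⟩, by simp [h2], ?_⟩
      intro v hv
      rcases List.mem_cons.1 hv with rfl | hv
      · exact hy
      · exact Finset.mem_of_mem_erase (h3 v hv)
    · rintro ⟨h1, h2, h3⟩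
      cases l with
      | nil => simp at h2
      | cons y l =>
        rw [List.nodup_cons] at h1
        refine ⟨y, h3 y (by simp), l, ⟨h1.2, by simpa using h2, fun v hv => ?_⟩, rfl⟩
        exact Finset.mem_erase.2 ⟨fun h => h1.1 (h ▸ hv), h3 v (by simp [hv])⟩

theorem sum_orderings_succ (m : ℕ) (T : Finset V) (f : List V → ℝ) :
    ∑ l ∈ orderings (m + 1) T, f l = ∑ y ∈ T, ∑ l ∈ orderings m (T.erase y), f (y :: l) := by
  rw [orderings, Finset.sum_biUnion]
  · refine Finset.sum_congr rfl fun y _ => ?_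
    rw [Finset.sum_image]
    intro l _ l' _ h
    simpa using h
  · intro y _ y' _ hyy'
    rw [Function.onFun, Finset.disjoint_left]
    intro l hl hl'
    obtain ⟨l1, _, rfl⟩ := Finset.mem_image.1 hl
    obtain ⟨l2, _, h⟩ := Finset.mem_image.1 hl'
    exact hyy' (List.cons.inj h).1.symm

theorem card_orderings (m : ℕ) (T : Finset V) (h : T.card = m) :
    (orderings m T).card = m.factorial := by
  induction m generalizing T with
  | zero => simp [orderings]
  | succ m ih =>
    have h1 := sum_orderings_succ m T fun _ => 1
    simp only [Finset.sum_const, nsmul_eq_mul, mul_one] at h1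
    rw [Finset.sum_congr rfl fun y hy => by
      rw [ih (T.erase y) (by rw [Finset.card_erase_of_mem hy, h]; rfl)]] at h1
    simp only [Finset.sum_const, nsmul_eq_mul, h] at h1
    rw [Nat.factorial_succ]
    exact_mod_cast h1

/-- Induction on the number of vertices left, conditioning on the next one. The initial
discrepancies count in full, and the supermartingale pays for all later ones. -/
theorem sum_card_discrepancies_le (m : ℕ) {T P Q : Finset V} (hm : T.card = m) (hP : P ⊆ T)
    (hQ : Q ⊆ T) :
    ∑ l ∈ orderings m T, ((discrepancies G G l P Q).card : ℝ) ≤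
      m.factorial * ((symmDiff P Q).card + potential G P Q) := by
  induction m generalizing T P Q with
  | zero =>
    have := potential_nonneg G P Q
    simpa [orderings, discrepancies] using this
  | succ m ih =>
    rw [sum_orderings_succ]
    have h1 : ∀ y ∈ T, ∑ l ∈ orderings m (T.erase y),
        ((discrepancies G G (y :: l) P Q).card : ℝ) ≤
        m.factorial * ((symmDiff P Q).card +
          (((symmDiff (step G y P) (step G y Q) \ symmDiff P Q).card : ℝ) +
            potential G (step G y P) (step G y Q))) := by
      intro y hy
      have hc : (T.erase y).card = m := by rw [Finset.card_erase_of_mem hy, hm]; rfl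
      have h2 := ih hc (step_subset_erase G hP) (step_subset_erase G hQ)
      set D := symmDiff P Q with hD
      set D' := symmDiff (step G y P) (step G y Q) with hD'
      -- Discrepancies that survive the step are counted again in the tail, so only `D \ D'` has to
      -- be added.
      have h3 : ∀ l, ((discrepancies G G (y :: l) P Q).card : ℝ) ≤
          (D \ D').card + (discrepancies G G l (step G y P) (step G y Q)).card := by
        intro l
        norm_cast
        refine le_trans (Finset.card_le_card ?_) (Finset.card_union_le _ _)
        have h4 := symmDiff_subset_discrepancies G G l (step G y P) (step G y Q)
        intro v hv
        rw [discrepancies, Finset.mem_union] at hv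
        rw [Finset.mem_union, Finset.mem_sdiff]
        have := @h4 v
        tauto
      refine (Finset.sum_le_sum fun l _ => h3 l).trans ?_
      rw [Finset.sum_add_distrib, Finset.sum_const, card_orderings m _ hc, nsmul_eq_mul]
      have e1 := Finset.card_sdiff_add_card_inter D D'
      have e2 := Finset.card_sdiff_add_card_inter D' D
      rw [Finset.inter_comm] at e2
      have e3 : ((D \ D').card : ℝ) + D'.card = D.card + (D' \ D).card := by
        norm_cast
        omega
      have e4 : (m.factorial : ℝ) * ((D \ D').card + D'.card) =
        m.factorial * (D.card + (D' \ D).card) := by rw [e3]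
      linarith
    refine (Finset.sum_le_sum h1).trans ?_
    rw [← Finset.mul_sum, Finset.sum_add_distrib, Finset.sum_const, nsmul_eq_mul]
    have h2 := sum_potential_step_le G hP hQ
    rw [Nat.factorial_succ, ← hm]
    push_cast
    have h3 : (0 : ℝ) ≤ m.factorial := by positivity
    calc _ ≤ (m.factorial : ℝ) * (T.card * (symmDiff P Q).card + T.card * potential G P Q) := by
          gcongr
      _ = _ := by ring

end Parallel

/-! ### Eliminators and the greedy process on a sorted list -/

section Eliminator

theorem key_injective {V : Type*} (π : V → ℝ) : Function.Injective (key π) := fun u v h => by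
  simpa [key] using congrArg (fun p => (ofLex p).2) h

variable {V : Type*} [LinearOrder V]

theorem key_lt_iff {π : V → ℝ} {u v : V} :
    key π u < key π v ↔ π u < π v ∨ π u = π v ∧ u < v := Prod.Lex.toLex_lt_toLex

theorem exists_sorted_list (π : V → ℝ) (s : Finset V) :
    ∃ l : List V, l.Pairwise (fun u v => key π u < key π v) ∧ ∀ v, v ∈ l ↔ v ∈ s := by
  induction s using Finset.strongInduction with
  | H s ih =>
    by_cases hs : s.Nonempty
    · obtain ⟨l, h1, h2⟩ := ih _ (Finset.erase_ssubset (lowest_mem π s hs))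
      refine ⟨lowest π s hs :: l, List.pairwise_cons.2 ⟨fun v hv => ?_, h1⟩, fun v => ?_⟩
      · have h3 := Finset.mem_erase.1 ((h2 v).1 hv)
        exact (key_lowest_le π s hs h3.2).lt_of_ne fun h => h3.1 (key_injective π h).symm
      · rw [List.mem_cons, h2, Finset.mem_erase]
        have := lowest_mem π s hs
        by_cases h : v = lowest π s hs
        · simp [h, this]
        · simp [h]
    · refine ⟨[], List.Pairwise.nil, fun v => ?_⟩
      rw [Finset.not_nonempty_iff_eq_empty.1 hs]
      simp

theorem lowest_congr {π π' : V → ℝ} (h : ∀ u v, key π u ≤ key π v ↔ key π' u ≤ key π' v)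
    (s : Finset V) (hs : s.Nonempty) : lowest π s hs = lowest π' s hs :=
  key_injective π' <| le_antisymm ((h _ _).1 (key_lowest_le π s hs (lowest_mem π' s hs)))
    (key_lowest_le π' s hs (lowest_mem π s hs))

theorem greedy_congr (G : SimpleGraph V) {π π' : V → ℝ} (h : ∀ u v, key π u ≤ key π v ↔ key π' u ≤ key π' v)
    (alive : Finset V) : greedy G π alive = greedy G π' alive := by
  induction alive using greedy.induct G π with
  | case1 alive hs ih =>
    rw [greedy, dif_pos hs, ih, greedy.eq_def G π' alive, dif_pos hs, lowest_congr h]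
  | case2 alive hs =>
    rw [greedy, dif_neg hs, greedy, dif_neg hs]

theorem greedy_subset (G : SimpleGraph V) (π : V → ℝ) (alive : Finset V) :
    greedy G π alive ⊆ alive := by
  induction alive using greedy.induct G π with
  | case1 alive h ih =>
    rw [greedy, dif_pos h]
    refine Finset.insert_subset (lowest_mem π alive h) (ih.trans ?_)
    classical
    exact Finset.filter_subset _ _
  | case2 alive h =>
    rw [greedy, dif_neg h]
    exact Finset.empty_subset _

theorem not_adj_of_mem_greedy (G : SimpleGraph V) (π : V → ℝ) (alive : Finset V) :
    ∀ u ∈ greedy G π alive, ∀ v ∈ greedy G π alive, ¬ G.Adj u v := by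
  induction alive using greedy.induct G π with
  | case1 alive h ih =>
    rw [greedy, dif_pos h]
    have h1 : ∀ v ∈ greedy G π (survivors G alive (lowest π alive h)),
        ¬ G.Adj (lowest π alive h) v := fun v hv => by
      have := greedy_subset G π _ hv
      simp only [survivors, Finset.mem_filter] at this
      exact this.2.2
    intro u hu v hv
    rcases Finset.mem_insert.1 hu with rfl | hu' <;> rcases Finset.mem_insert.1 hv with rfl | hv'
    · exact G.loopless.irrefl _
    · exact h1 v hv'
    · exact fun h => h1 u hu' h.symm
    · exact ih u hu' v hv'
  | case2 alive h =>
    rw [greedy, dif_neg h]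
    simp

/-- A vertex is killed no later than its own turn; hence an eliminator never comes after the vertex
it eliminates. -/
theorem exists_mem_greedy_le (G : SimpleGraph V) (π : V → ℝ) (alive : Finset V) :
    ∀ v ∈ alive, ∃ u ∈ greedy G π alive, (u = v ∨ G.Adj v u) ∧ key π u ≤ key π v := by
  induction alive using greedy.induct G π with
  | case1 alive h ih =>
    intro v hv
    rw [greedy, dif_pos h]
    have hle := key_lowest_le π alive h hv
    by_cases h1 : v = lowest π alive h
    · exact ⟨_, Finset.mem_insert_self _ _, Or.inl h1.symm, hle⟩
    by_cases h2 : G.Adj (lowest π alive h) v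
    · exact ⟨_, Finset.mem_insert_self _ _, Or.inr h2.symm, hle⟩
    obtain ⟨u, hu, h3⟩ := ih v (by simp [survivors, hv, h1, h2])
    exact ⟨u, Finset.mem_insert_of_mem hu, h3⟩
  | case2 alive h =>
    intro v hv
    exact absurd ⟨v, hv⟩ h

variable [Fintype V] (G G' : SimpleGraph V) (π : V → ℝ)

theorem eliminator_mem (v : V) :
    eliminator G π v ∈ lfmis G π ∧ (eliminator G π v = v ∨ G.Adj v (eliminator G π v)) := by
  have := lowest_mem π _ (dominators_nonempty G π v)
  classical
  exact Finset.mem_filter.1 this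

theorem key_eliminator_le_of_mem {u v : V} (hu : u ∈ lfmis G π) (h : u = v ∨ G.Adj v u) :
    key π (eliminator G π v) ≤ key π u :=
  key_lowest_le π _ (dominators_nonempty G π v)
    (by simp only [dominators, Finset.mem_filter]; exact ⟨hu, h⟩)

theorem key_eliminator_le (v : V) : key π (eliminator G π v) ≤ key π v := by
  obtain ⟨u, hu, h, hle⟩ := exists_mem_greedy_le G π Finset.univ v (Finset.mem_univ v)
  exact (key_eliminator_le_of_mem G π hu h).trans hle

theorem eliminator_eq_self_iff (v : V) : eliminator G π v = v ↔ v ∈ lfmis G π := by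
  refine ⟨fun h => h ▸ (eliminator_mem G π v).1, fun h => ?_⟩
  refine (eliminator_mem G π v).2.resolve_right fun h' => ?_
  exact not_adj_of_mem_greedy G π _ _ h _ (eliminator_mem G π v).1 h'

/-- If `P` is the set of the vertices that are alive when the process has reached the sorted list
`y :: l`, then `step G y P` is the set of those alive when it has reached `l`. -/
theorem mem_step_iff_eliminator [DecidableRel G.Adj] {y : V} {l : List V} {P : Finset V}
    (hl : (y :: l).Pairwise fun u v => key π u < key π v)
    (hP : ∀ v, v ∈ P ↔ eliminator G π v ∈ y :: l) (v : V) :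
    v ∈ step G y P ↔ eliminator G π v ∈ l := by
  have hy : ∀ u ∈ l, key π y < key π u := (List.pairwise_cons.1 hl).1
  have hyl : y ∉ l := fun h => lt_irrefl _ (hy y h)
  -- The eliminator of `y` cannot come later than `y`, so `y` is still alive at its turn exactly
  -- when it eliminates itself.
  have hyP : y ∈ P ↔ y ∈ lfmis G π := by
    rw [hP, List.mem_cons, ← eliminator_eq_self_iff, or_iff_left]
    exact fun h => (hy _ h).not_ge (key_eliminator_le G π y)
  rw [mem_step, hP, List.mem_cons]
  constructor
  · rintro ⟨h | h, h'⟩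
    · have h2 := eliminator_mem G π v
      rw [h] at h2
      have h3 := h' (hyP.2 h2.1)
      rcases h2.2 with h4 | h4
      · exact absurd h4.symm h3.1
      · exact absurd h4.symm h3.2
    · exact h
  · intro h
    refine ⟨Or.inr h, fun h1 => ?_⟩
    have h2 : ¬ (y = v ∨ G.Adj v y) := fun h3 =>
      (hy _ h).not_ge (key_eliminator_le_of_mem G π (hyP.1 h1) h3)
    exact ⟨fun h3 => h2 (Or.inl h3.symm), fun h3 => h2 (Or.inr h3.symm)⟩

/-- A vertex that is never a discrepancy dies at the same step in both processes, and the vertex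
treated at that step is its eliminator in both. -/
theorem eliminator_mem_of_notMem_discrepancies [DecidableRel G.Adj] [DecidableRel G'.Adj]
    {l : List V} {P Q : Finset V} (hl : l.Pairwise fun u v => key π u < key π v)
    (hP : ∀ v, v ∈ P ↔ eliminator G π v ∈ l) (hQ : ∀ v, v ∈ Q ↔ eliminator G' π v ∈ l)
    {v : V} (hv : v ∉ discrepancies G G' l P Q) (h : eliminator G π v ∈ l) :
    eliminator G π v = eliminator G' π v := by
  induction l generalizing P Q with
  | nil => simp at h
  | cons y l ih =>
    have hv1 : v ∉ symmDiff P Q := fun h1 => hv (symmDiff_subset_discrepancies _ _ _ _ _ h1)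
    have hv2 : v ∉ discrepancies G G' l (step G y P) (step G' y Q) := fun h1 =>
      hv (by rw [discrepancies]; exact Finset.mem_union_right _ h1)
    have h1 := mem_step_iff_eliminator G π hl hP
    have h2 := mem_step_iff_eliminator G' π hl hQ
    by_cases h3 : eliminator G π v ∈ l
    · exact ih (List.pairwise_cons.1 hl).2 h1 h2 hv2 h3
    · have h4 : v ∉ symmDiff (step G y P) (step G' y Q) := fun h4 =>
        hv2 (symmDiff_subset_discrepancies _ _ _ _ _ h4)
      rw [Finset.mem_symmDiff, h1, h2] at h4
      rw [Finset.mem_symmDiff, hP, hQ, List.mem_cons, List.mem_cons] at hv1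
      rw [List.mem_cons] at h
      have h5 : eliminator G π v = y := by tauto
      have h6 : eliminator G' π v = y := by tauto
      rw [h5, h6]

theorem affected_subset_discrepancies [DecidableRel G.Adj] [DecidableRel G'.Adj]
    {l : List V} (hl : l.Pairwise fun u v => key π u < key π v) (hm : ∀ v, v ∈ l) :
    affected G G' π ⊆ discrepancies G G' l Finset.univ Finset.univ := by
  intro v hv
  by_contra h
  refine (Finset.mem_filter.1 hv).2 (eliminator_mem_of_notMem_discrepancies G G' π hl ?_ ?_ h
    (hm _)) <;> simp [hm]

variable {π}

theorem eliminator_congr {π' : V → ℝ} (h : ∀ u v, key π u ≤ key π v ↔ key π' u ≤ key π' v)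
    (v : V) : eliminator G π v = eliminator G π' v := by
  have h1 : lfmis G π = lfmis G π' := greedy_congr G h _
  have h2 := eliminator_mem G π v
  have h3 := eliminator_mem G π' v
  rw [h1] at h2
  rw [← h1] at h3
  exact key_injective π' <| le_antisymm ((h _ _).1 (key_eliminator_le_of_mem G π h3.1 h3.2))
    (key_eliminator_le_of_mem G π' h2.1 h2.2)

/-- The set of affected vertices depends only on the order of the vertices. -/
theorem affected_congr {π' : V → ℝ} (h : ∀ u v, key π u ≤ key π v ↔ key π' u ≤ key π' v) :
    affected G G' π = affected G G' π' := by
  unfold affected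
  simp only [eliminator_congr _ h]

end Eliminator


/-! ### Edge updates -/

section Update

variable {V : Type*} {G G' : SimpleGraph V} {a b : V}

theorem IsEdgeUpdate.adj_iff (h : IsEdgeUpdate G G' a b) {u v : V} (h1 : ¬ (u = a ∧ v = b))
    (h2 : ¬ (u = b ∧ v = a)) : G.Adj u v ↔ G'.Adj u v := by
  rcases h with ⟨_, rfl⟩ | ⟨_, rfl⟩
  · rw [SimpleGraph.sup_adj, SimpleGraph.edge_adj]
    tauto
  · rw [SimpleGraph.deleteEdges_adj, Set.mem_singleton_iff, Sym2.eq_iff]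
    tauto

theorem IsEdgeUpdate.swap (h : IsEdgeUpdate G G' a b) : IsEdgeUpdate G G' b a := by
  rcases h with ⟨h, h'⟩ | ⟨h, h'⟩
  · exact Or.inl ⟨fun h1 => h h1.symm, by rw [h', SimpleGraph.edge_comm]⟩
  · exact Or.inr ⟨h.symm, by rw [h', Sym2.eq_swap]⟩

variable [LinearOrder V] [DecidableRel G.Adj] [DecidableRel G'.Adj]

theorem step_congr {y : V} {P : Finset V} (h : ∀ v ∈ P, y ∈ P → (G.Adj y v ↔ G'.Adj y v)) :
    step G y P = step G' y P := by
  ext v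
  simp only [mem_step]
  have := h v
  tauto

/-- The changed edge is consulted only while `a` is alive. -/
theorem IsEdgeUpdate.discrepancies_eq (h : IsEdgeUpdate G G' a b) (l : List V) {P Q : Finset V}
    (hP : a ∉ P) (hQ : a ∉ Q) : discrepancies G G' l P Q = discrepancies G G l P Q := by
  induction l generalizing P Q with
  | nil => rfl
  | cons y l ih =>
    have h1 : step G' y Q = step G y Q := by
      refine (step_congr fun v hv hy => h.adj_iff ?_ ?_).symm
      · rintro ⟨rfl, _⟩
        exact hQ hy
      · rintro ⟨_, rfl⟩
        exact hQ hv
    rw [discrepancies, discrepancies, h1, ih]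
    · exact fun h2 => hP (mem_step _ |>.1 h2).1
    · exact fun h2 => hQ (mem_step _ |>.1 h2).1

variable [Fintype V]

/-- A step looks only at edges at the treated vertex, so the processes agree until `a` or `b` is
treated. Here `P'` is their common alive set after `pre`. -/
theorem IsEdgeUpdate.discrepancies_append (h : IsEdgeUpdate G G' a b) {pre : List V}
    (ha : a ∉ pre) (hb : b ∉ pre) (P : Finset V) :
    ∃ P' : Finset V, (∀ v ∈ P', v ∈ P ∧ v ∉ pre) ∧
      ∀ l, discrepancies G G' (pre ++ l) P P = discrepancies G G' l P' P' := by
  induction pre generalizing P with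
  | nil => exact ⟨P, by simp, fun l => rfl⟩
  | cons y pre ih =>
    rw [List.mem_cons, not_or] at ha hb
    obtain ⟨P', h1, h2⟩ := ih ha.2 hb.2 (step G y P)
    have h3 : step G' y P = step G y P :=
      (step_congr fun v _ _ => h.adj_iff (fun h4 => ha.1 h4.1.symm)
        (fun h4 => hb.1 h4.1.symm)).symm
    refine ⟨P', fun v hv => ?_, fun l => ?_⟩
    · have h4 := h1 v hv
      rw [mem_step] at h4
      refine ⟨h4.1.1, ?_⟩
      rw [List.mem_cons, not_or]
      refine ⟨?_, h4.2⟩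
      rintro rfl
      exact (h4.1.2 h4.1.1).1 rfl
    · rw [List.cons_append, discrepancies, h3, symmDiff_self, Finset.bot_eq_empty,
        Finset.empty_union, h2]

/-- If all the vertices of `pre` precede `a`, and all those of `T` follow it in a random order,
then at most `1 + log n` vertices are affected, in expectation. -/
theorem IsEdgeUpdate.sum_orderings_le (h : IsEdgeUpdate G G' a b) {pre : List V} {T : Finset V}
    (ha : a ∉ pre) (hb : b ∉ pre) (hT : ∀ v, v ∈ pre ∨ v = a ∨ v ∈ T) :
    ∑ l ∈ orderings T.card T,
      ((discrepancies G G' (pre ++ a :: l) Finset.univ Finset.univ).card : ℝ) ≤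
      T.card.factorial * (1 + Real.log (Fintype.card V)) := by
  obtain ⟨R, hR, hl⟩ := h.discrepancies_append ha hb Finset.univ
  simp only [hl]
  have hsub : ∀ (H : SimpleGraph V) [DecidableRel H.Adj], step H a R ⊆ T := by
    intro H _ v hv
    rw [mem_step] at hv
    have h1 := (hR v hv.1).2
    rcases hT v with h2 | rfl | h2
    · exact absurd h2 h1
    · exact absurd rfl (hv.2 hv.1).1
    · exact h2
  have hna : ∀ (H : SimpleGraph V) [DecidableRel H.Adj], a ∉ step H a R := by
    intro H _ hv
    rw [mem_step] at hv
    exact (hv.2 hv.1).1 rfl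
  -- The neighborhoods of `a` in the two graphs differ only in `b`.
  have hD : symmDiff (step G a R) (step G' a R) ⊆ {b} := by
    intro v hv
    rw [Finset.mem_singleton]
    by_contra hvb
    have h1 : G.Adj a v ↔ G'.Adj a v := h.adj_iff (fun h1 => hvb h1.2) (fun h1 => hvb (by
      rw [h1.2, h1.1]))
    rw [Finset.mem_symmDiff, mem_step, mem_step] at hv
    tauto
  have hlog : ∀ l, discrepancies G G' (a :: l) R R =
      discrepancies G G l (step G a R) (step G' a R) := by
    intro l
    rw [discrepancies, symmDiff_self, Finset.bot_eq_empty, Finset.empty_union,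
      h.discrepancies_eq l (hna G) (hna G')]
  simp only [hlog]
  refine (sum_card_discrepancies_le G T.card rfl (hsub G) (hsub G')).trans ?_
  have h1 : ((symmDiff (step G a R) (step G' a R)).card : ℝ) ≤ 1 := by
    exact_mod_cast (Finset.card_le_card hD).trans (Finset.card_singleton b).le
  have h2 : potential G (step G a R) (step G' a R) ≤ Real.log (Fintype.card V) := by
    refine (Finset.sum_le_sum_of_subset_of_nonneg hD fun w _ _ =>
      Real.log_nonneg (by simp)).trans ?_
    rw [Finset.sum_singleton]
    refine Real.log_le_log (by positivity) ?_
    -- No vertex is its own neighbor, so `1 + d ≤ n` and the initial potential is at most `log n`.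
    have h3 : (nbrs G (step G a R ∩ step G' a R) b).card < Fintype.card V :=
      Finset.card_lt_univ_of_notMem (x := b) fun h3 => by
        simp [nbrs] at h3
    rw [add_comm]
    exact_mod_cast h3
  gcongr

/-- The expected number of affected vertices, if the order of the vertices that follow `a` is
random. -/
theorem IsEdgeUpdate.sum_perm_le (h : IsEdgeUpdate G G' a b) {π : V → ℝ} {T : Finset V}
    (hab : a ≠ b) (hb : b ∈ T) (hT : ∀ v ∈ T, π a < π v) (hT' : ∀ v, v ∉ T → v ≠ a → π v < π a)
    (hinj : Set.InjOn π T) :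
    ∑ τ : Equiv.Perm {v // v ∈ T},
      ((affected G G' (π ∘ Equiv.Perm.ofSubtype τ)).card : ℝ) ≤
      T.card.factorial * (1 + Real.log (Fintype.card V)) := by
  have haT : a ∉ T := fun h1 => lt_irrefl _ (hT a h1)
  obtain ⟨pre, hpre, hpre'⟩ := exists_sorted_list π ((Finset.univ \ T).erase a)
  obtain ⟨w, hw, hw'⟩ := exists_sorted_list π T
  have hpre'' : ∀ v ∈ pre, v ∉ T ∧ v ≠ a := fun v hv => by
    have := (hpre' v).1 hv
    simp only [Finset.mem_erase, Finset.mem_sdiff] at this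
    tauto
  -- The ranking permuted by `τ` gives `τ⁻¹ v` the rank `π v`, so `τ⁻¹` maps the sorted list of `T`
  -- to the newly sorted one.
  set f : Equiv.Perm {v // v ∈ T} → List V := fun τ => w.map (Equiv.Perm.ofSubtype τ⁻¹) with hf
  have hfinj : Function.Injective f := by
    intro τ τ' hττ'
    have h1 := List.map_inj_left.1 hττ'
    refine inv_injective (Equiv.ext fun v => ?_)
    have h2 := h1 v ((hw' _).2 v.2)
    rw [Equiv.Perm.ofSubtype_apply_coe, Equiv.Perm.ofSubtype_apply_coe] at h2
    exact Subtype.ext h2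
  have hmemT : ∀ (τ : Equiv.Perm {v // v ∈ T}) (v : V), v ∈ T → Equiv.Perm.ofSubtype τ v ∈ T := by
    intro τ v hv
    rw [Equiv.Perm.ofSubtype_apply_of_mem τ hv]
    exact (τ ⟨v, hv⟩).2
  have hfix : ∀ (τ : Equiv.Perm {v // v ∈ T}) (v : V), v ∉ T → Equiv.Perm.ofSubtype τ v = v :=
    fun τ v hv => Equiv.Perm.ofSubtype_apply_of_not_mem τ hv
  have hfmem : ∀ τ, f τ ∈ orderings T.card T := by
    intro τ
    have hnd : w.Nodup := hw.imp fun h1 h2 => h1.ne (congrArg _ h2)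
    rw [mem_orderings]
    refine ⟨hnd.map (Equiv.injective _), ?_, ?_⟩
    · rw [List.length_map, ← List.toFinset_card_of_nodup hnd]
      congr 1
      ext v
      rw [List.mem_toFinset, hw']
    · intro v hv
      obtain ⟨u, hu, rfl⟩ := List.mem_map.1 hv
      exact hmemT _ _ ((hw' u).1 hu)
  have hle : ∀ τ, affected G G' (π ∘ Equiv.Perm.ofSubtype τ) ⊆
      discrepancies G G' (pre ++ a :: f τ) Finset.univ Finset.univ := by
    intro τ
    have hback : ∀ v, (π ∘ Equiv.Perm.ofSubtype τ) (Equiv.Perm.ofSubtype τ⁻¹ v) = π v := by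
      intro v
      rw [map_inv]
      simp
    have hfix' : ∀ v, v ∉ T → (π ∘ Equiv.Perm.ofSubtype τ) v = π v := fun v hv => by
      rw [Function.comp_apply, hfix τ v hv]
    have hgt : ∀ v ∈ f τ, ∃ u ∈ T, (π ∘ Equiv.Perm.ofSubtype τ) v = π u := by
      intro v hv
      obtain ⟨u, hu, rfl⟩ := List.mem_map.1 hv
      exact ⟨u, (hw' u).1 hu, hback u⟩
    refine affected_subset_discrepancies G G' _ ?_ ?_
    · rw [List.pairwise_append, List.pairwise_cons]
      refine ⟨?_, ⟨?_, ?_⟩, ?_⟩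
      · refine hpre.imp_of_mem fun {u v} hu hv huv => ?_
        rw [key_lt_iff] at huv ⊢
        rwa [hfix' u (hpre'' u hu).1, hfix' v (hpre'' v hv).1]
      · intro v hv
        obtain ⟨u, hu, h1⟩ := hgt v hv
        rw [key_lt_iff, h1, hfix' a haT]
        exact Or.inl (hT u hu)
      · rw [hf, List.pairwise_map]
        refine hw.imp_of_mem fun {u v} hu hv huv => ?_
        rw [key_lt_iff] at huv ⊢
        rw [hback, hback]
        rcases huv with huv | huv
        · exact Or.inl huv
        -- A tie inside `T` would be broken by identifiers, which `τ` does not respect; injectivity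
        -- excludes it.
        · exact absurd (hinj ((hw' u).1 hu) ((hw' v).1 hv) huv.1) huv.2.ne
      · intro u hu v hv
        have h1 := hpre'' u hu
        have h2 := hT' u h1.1 h1.2
        rw [key_lt_iff, hfix' u h1.1]
        rcases List.mem_cons.1 hv with rfl | hv
        · rw [hfix' v haT]
          exact Or.inl h2
        · obtain ⟨t, ht, h3⟩ := hgt v hv
          rw [h3]
          exact Or.inl (h2.trans (hT t ht))
    · intro v
      rw [List.mem_append, List.mem_cons]
      by_cases hv : v ∈ T
      · refine Or.inr (Or.inr (List.mem_map.2 ⟨Equiv.Perm.ofSubtype τ v, ?_, ?_⟩))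
        · exact (hw' _).2 (hmemT τ v hv)
        · rw [map_inv]
          simp
      · by_cases hva : v = a
        · exact Or.inr (Or.inl hva)
        · refine Or.inl ((hpre' v).2 ?_)
          simp [hv, hva]
  calc _ ≤ ∑ τ : Equiv.Perm {v // v ∈ T},
        ((discrepancies G G' (pre ++ a :: f τ) Finset.univ Finset.univ).card : ℝ) := by
        gcongr with τ
        exact hle τ
    _ = ∑ l ∈ Finset.univ.image f,
        ((discrepancies G G' (pre ++ a :: l) Finset.univ Finset.univ).card : ℝ) := by
        rw [Finset.sum_image hfinj.injOn]
    _ ≤ ∑ l ∈ orderings T.card T,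
        ((discrepancies G G' (pre ++ a :: l) Finset.univ Finset.univ).card : ℝ) := by
        refine Finset.sum_le_sum_of_subset_of_nonneg ?_ fun _ _ _ => by positivity
        intro l hl
        obtain ⟨τ, _, rfl⟩ := Finset.mem_image.1 hl
        exact hfmem τ
    _ ≤ _ := by
        refine h.sum_orderings_le (fun h1 => (hpre'' a h1).2 rfl) (fun h1 => (hpre'' b h1).1 hb)
          fun v => ?_
        rw [hpre']
        simp only [Finset.mem_erase, Finset.mem_sdiff, Finset.mem_univ, true_and]
        tauto

/-- The number of affected vertices, if `b` is the only vertex that follows `a`. -/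
theorem IsEdgeUpdate.card_affected_le (h : IsEdgeUpdate G G' a b) {π : V → ℝ}
    (hab : key π a < key π b) (hT : ∀ v, v ≠ a → v ≠ b → key π v < key π a) :
    ((affected G G' π).card : ℝ) ≤ 1 + Real.log (Fintype.card V) := by
  have hne : a ≠ b := fun h1 => hab.ne (congrArg _ h1)
  obtain ⟨pre, hpre, hpre'⟩ := exists_sorted_list π ((Finset.univ.erase b).erase a)
  simp only [Finset.mem_erase, Finset.mem_univ, and_true] at hpre'
  have h1 := h.sum_orderings_le (pre := pre) (T := {b}) (fun h1 => ((hpre' a).1 h1).1 rfl)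
    (fun h1 => ((hpre' b).1 h1).2 rfl) fun v => by
      rw [hpre', Finset.mem_singleton]
      tauto
  have h2 : affected G G' π ⊆ discrepancies G G' (pre ++ a :: [b]) Finset.univ Finset.univ := by
    refine affected_subset_discrepancies G G' _ ?_ ?_
    · rw [List.pairwise_append]
      refine ⟨hpre, by simpa using hab, fun u hu v hv => ?_⟩
      have h3 := (hpre' u).1 hu
      have h4 := hT u h3.1 h3.2
      simp only [List.mem_cons, List.not_mem_nil, or_false] at hv
      rcases hv with rfl | rfl
      · exact h4
      · exact h4.trans hab
    · intro v
      simp only [List.mem_append, List.mem_cons, List.not_mem_nil, or_false, hpre']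
      tauto
  have h3 : orderings (Finset.card {b}) {b} = {[b]} := by
    simp [orderings]
  rw [h3, Finset.sum_singleton] at h1
  refine le_trans (by exact_mod_cast Finset.card_le_card h2) (h1.trans (le_of_eq ?_))
  simp

end Update

/-! ### Ranks uniform in the unit interval -/

section RealRanks

instance : NullSingletonClass unif := by unfold unif; infer_instance

variable {V : Type*}

theorem ae_rankLaw_eval [Fintype V] (v : V) {p : ℝ → Prop} (h : ∀ᵐ x ∂unif, p x) :
    ∀ᵐ ρ ∂rankLaw V, p (ρ v) :=
  (measurePreserving_eval (fun _ : V => unif) v).quasiMeasurePreserving.ae h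

theorem ae_rankLaw_ne [Fintype V] (u : V) (c : ℝ) : ∀ᵐ ρ ∂rankLaw V, ρ u ≠ c :=
  ae_rankLaw_eval u (p := fun x => x ≠ c) (by simp [ae_iff])

/-- Exchangeability of the ranks. -/
theorem measurePreserving_comp_perm [Fintype V] (σ : Equiv.Perm V) :
    MeasurePreserving (fun ρ : V → ℝ => ρ ∘ σ) (rankLaw V) (rankLaw V) := by
  have h := measurePreserving_piCongrLeft (fun _ : V => unif) σ.symm
  have h1 : (fun ρ : V → ℝ => ρ ∘ σ) =
      MeasurableEquiv.piCongrLeft (fun _ : V => ℝ) σ.symm := by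
    ext ρ v
    conv_rhs => rw [← σ.symm_apply_apply v, MeasurableEquiv.piCongrLeft_apply_apply]
    rfl
  rw [h1]
  exact h

variable [LinearOrder V]

theorem measurableSet_key_le (u v : V) : MeasurableSet {π : V → ℝ | key π u ≤ key π v} := by
  have h : {π : V → ℝ | key π u ≤ key π v} = {π | π u < π v} ∪ {π | π u = π v ∧ u ≤ v} := by
    ext π
    exact Prod.Lex.toLex_le_toLex
  rw [h]
  refine (measurableSet_lt (by fun_prop) (by fun_prop)).union ?_
  by_cases huv : u ≤ v
  · simpa [huv] using measurableSet_eq_fun (f := fun π : V → ℝ => π u) (g := fun π => π v)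
      (by fun_prop) (by fun_prop)
  · simp [huv]

variable [Fintype V]

/-- The affected set factors through the finite table of comparisons between keys, each of which is
measurable. -/
theorem measurable_card_affected (G G' : SimpleGraph V) :
    Measurable fun π : V → ℝ => ((affected G G' π).card : ℝ≥0∞) := by
  classical
  let pattern : (V → ℝ) → V → V → Bool := fun π u v => decide (key π u ≤ key π v)
  have hp : Measurable pattern := by
    refine measurable_pi_iff.2 fun u => measurable_pi_iff.2 fun v => ?_
    refine measurable_to_bool ?_
    convert measurableSet_key_le u v using 1
    ext π
    simp [pattern]
  have hfac : Function.FactorsThrough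
      (fun π : V → ℝ => ((affected G G' π).card : ℝ≥0∞)) pattern := by
    intro π π' h
    have h1 : affected G G' π = affected G G' π' := affected_congr G G' fun u v => by
      have := congrFun (congrFun h u) v
      simpa [pattern] using this
    simp only [h1]
  have : (fun π : V → ℝ => ((affected G G' π).card : ℝ≥0∞)) =
      Function.extend pattern (fun π : V → ℝ => ((affected G G' π).card : ℝ≥0∞)) 0 ∘ pattern := by
    ext π
    exact (hfac.extend_apply 0 π).symm
  rw [this]
  exact (measurable_of_finite _).comp hp

theorem ae_rankLaw_ne_of_ne {u v : V} (h : u ≠ v) : ∀ᵐ ρ ∂rankLaw V, ρ u ≠ ρ v := by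
  have hm : MeasurableSet {ρ : V → ℝ | ρ u = ρ v} :=
    measurableSet_eq_fun (by fun_prop) (by fun_prop)
  rw [ae_iff]
  simp only [ne_eq, not_not]
  rw [← lintegral_indicator_one hm, ← lintegral_update u _ (measurable_one.indicator hm)]
  have h1 : ∀ (ρ : V → ℝ), ∫⁻ x, {ρ : V → ℝ | ρ u = ρ v}.indicator (1 : (V → ℝ) → ℝ≥0∞)
      (Function.update ρ u x) ∂unif = 0 := by
    intro ρ
    have h2 : ∀ x, {ρ : V → ℝ | ρ u = ρ v}.indicator (1 : (V → ℝ) → ℝ≥0∞)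
        (Function.update ρ u x) = ({ρ v} : Set ℝ).indicator 1 x := by
      intro x
      simp [Set.indicator, Function.update_of_ne h.symm]
    simp only [h2]
    rw [lintegral_indicator_one (measurableSet_singleton _)]
    simp
  simp [h1]

theorem ae_rankLaw_injective : ∀ᵐ ρ ∂rankLaw V, Function.Injective ρ := by
  have h : ∀ᵐ ρ ∂rankLaw V, ∀ u v, u ≠ v → ρ u ≠ ρ v := by
    rw [ae_all_iff]
    intro u
    rw [ae_all_iff]
    intro v
    by_cases huv : u = v
    · simp [huv]
    · filter_upwards [ae_rankLaw_ne_of_ne huv] with ρ hρ _ using hρ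
  filter_upwards [h] with ρ hρ u v huv
  by_contra hne
  exact hρ u v hne huv

/-- The law of `pin a b lam` is that of a random ranking with `a` moved to `lam`, conditioned on
the rank of `b` being above `lam`. -/
theorem mul_lintegral_pin {a b : V} (hab : a ≠ b) {lam : ℝ} (hlam : lam ∈ Set.Icc (0 : ℝ) 1)
    {F : (V → ℝ) → ℝ≥0∞} (hF : Measurable F) :
    ENNReal.ofReal (1 - lam) * ∫⁻ ρ, F (pin a b lam ρ) ∂rankLaw V =
      ∫⁻ ρ, {ρ : V → ℝ | lam < ρ b}.indicator (fun ρ => F (Function.update ρ a lam)) ρ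
        ∂rankLaw V := by
  have hS : MeasurableSet {ρ : V → ℝ | lam < ρ b} := measurableSet_lt (by fun_prop) (by fun_prop)
  have hu : Measurable fun ρ : V → ℝ => F (Function.update ρ a lam) :=
    hF.comp ((measurable_update_pair a).comp (f := fun ρ : V → ℝ => (ρ, lam)) (by fun_prop))
  have hh := hu.indicator hS
  rw [← lintegral_pin hab hlam.2 F hF, ← lintegral_unif_lt hlam, ← lintegral_update b _ hh,
    lintegral_lintegral_swap (f := fun (ρ : V → ℝ) y => {ρ : V → ℝ | lam < ρ b}.indicator
      (fun ρ => F (Function.update ρ a lam)) (Function.update ρ b y)) (hh.comp (measurable_update_pair b)).aemeasurable]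
  congr 1 with y
  by_cases hy : lam < y
  · simp [Set.indicator, hy, Function.update_comm hab]
  · simp [Set.indicator, hy]

/-! ### Averaging over the order of the vertices above `lam` -/

variable {G G' : SimpleGraph V} {a b : V}

/-- Permuting the ranks inside `T` preserves both the law and the event that `T` is the set of
vertices above `lam`. The integral therefore equals that of the average over permutations, which is
bounded for almost every ranking. -/
theorem IsEdgeUpdate.lintegral_upper_le (h : IsEdgeUpdate G G' a b) (hab : a ≠ b) (lam : ℝ)
    {T : Finset V} (haT : a ∉ T) (hbT : b ∈ T) :
    ∫⁻ ρ in {ρ : V → ℝ | ∀ v, v ≠ a → (v ∈ T ↔ lam < ρ v)},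
        ((affected G G' (Function.update ρ a lam)).card : ℝ≥0∞) ∂rankLaw V ≤
      ∫⁻ _ in {ρ : V → ℝ | ∀ v, v ≠ a → (v ∈ T ↔ lam < ρ v)},
        ENNReal.ofReal (1 + Real.log (Fintype.card V)) ∂rankLaw V := by
  classical
  set E := {ρ : V → ℝ | ∀ v, v ≠ a → (v ∈ T ↔ lam < ρ v)} with hE
  set f : (V → ℝ) → ℝ≥0∞ := fun ρ => ((affected G G' (Function.update ρ a lam)).card : ℝ≥0∞)
    with hf
  have hfm : Measurable f := (measurable_card_affected G G').comp
    ((measurable_update_pair a).comp (f := fun ρ : V → ℝ => (ρ, lam)) (by fun_prop))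
  have hEm : MeasurableSet E := by
    have : E = ⋂ v, {ρ : V → ℝ | v ≠ a → (v ∈ T ↔ lam < ρ v)} := by
      ext ρ
      simp [hE]
    rw [this]
    refine MeasurableSet.iInter fun v => ?_
    have hm : MeasurableSet {ρ : V → ℝ | lam < ρ v} :=
      measurableSet_lt (by fun_prop) (by fun_prop)
    by_cases h1 : v = a
    · simp [h1]
    · by_cases h2 : v ∈ T
      · simpa [h1, h2] using hm
      · convert hm.compl using 1
        ext ρ
        simp [h1, h2]
  have hmemT : ∀ (τ : Equiv.Perm {v // v ∈ T}) (v : V),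
      Equiv.Perm.ofSubtype τ v ∈ T ↔ v ∈ T := by
    intro τ v
    by_cases hv : v ∈ T
    · rw [Equiv.Perm.ofSubtype_apply_of_mem τ hv]
      simp [hv]
    · rw [Equiv.Perm.ofSubtype_apply_of_not_mem τ hv]
  have hfixa : ∀ τ : Equiv.Perm {v // v ∈ T}, Equiv.Perm.ofSubtype τ a = a :=
    fun τ => Equiv.Perm.ofSubtype_apply_of_not_mem τ haT
  have hpre : ∀ τ : Equiv.Perm {v // v ∈ T},
      (fun ρ : V → ℝ => ρ ∘ Equiv.Perm.ofSubtype τ) ⁻¹' E = E := by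
    intro τ
    ext ρ
    have hne : ∀ v, Equiv.Perm.ofSubtype τ v ≠ a ↔ v ≠ a := by
      intro v
      rw [not_iff_not]
      conv_lhs => rw [← hfixa τ]
      exact (Equiv.injective _).eq_iff
    simp only [Set.mem_preimage, hE, Set.mem_ofPred_eq, Function.comp_apply]
    rw [← (Equiv.Perm.ofSubtype τ).forall_congr_right
      (q := fun v => v ≠ a → (v ∈ T ↔ lam < ρ v))]
    simp only [hne, hmemT]
  have hinv : ∀ τ : Equiv.Perm {v // v ∈ T},
      ∫⁻ ρ in E, f (ρ ∘ Equiv.Perm.ofSubtype τ) ∂rankLaw V = ∫⁻ ρ in E, f ρ ∂rankLaw V := by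
    intro τ
    have h1 := (measurePreserving_comp_perm (Equiv.Perm.ofSubtype τ)).setLIntegral_comp_preimage
      hEm hfm
    rwa [hpre] at h1
  have hcard : Fintype.card (Equiv.Perm {v // v ∈ T}) = T.card.factorial := by
    rw [Fintype.card_perm, Fintype.card_coe]
  have hsum : (T.card.factorial : ℝ≥0∞) * ∫⁻ ρ in E, f ρ ∂rankLaw V =
      ∫⁻ ρ in E, ∑ τ : Equiv.Perm {v // v ∈ T}, f (ρ ∘ Equiv.Perm.ofSubtype τ) ∂rankLaw V := by
    rw [lintegral_finsetSum (f := fun (τ : Equiv.Perm {v // v ∈ T}) ρ =>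
      f (ρ ∘ Equiv.Perm.ofSubtype τ)) _ fun τ _ => hfm.comp (measurePreserving_comp_perm _).measurable]
    simp only [hinv, Finset.sum_const, nsmul_eq_mul, Finset.card_univ, hcard]
  have hbound : ∀ᵐ ρ ∂(rankLaw V).restrict E,
      ∑ τ : Equiv.Perm {v // v ∈ T}, f (ρ ∘ Equiv.Perm.ofSubtype τ) ≤
        T.card.factorial * ENNReal.ofReal (1 + Real.log (Fintype.card V)) := by
    have hne : ∀ᵐ ρ ∂rankLaw V, ∀ v, ρ v ≠ lam := ae_all_iff.2 fun v => ae_rankLaw_ne v lam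
    filter_upwards [ae_restrict_mem hEm, ae_restrict_of_ae ae_rankLaw_injective,
      ae_restrict_of_ae hne] with ρ hρE hρi hρn
    have h1 := h.sum_perm_le (π := Function.update ρ a lam) hab hbT (T := T) ?_ ?_ ?_
    -- Permutations of `T` fix `a`, so they commute with moving `a` to `lam`.
    · have h2 : ∀ τ : Equiv.Perm {v // v ∈ T}, Function.update (ρ ∘ Equiv.Perm.ofSubtype τ) a lam =
          Function.update ρ a lam ∘ Equiv.Perm.ofSubtype τ := by
        intro τ
        ext v
        by_cases hv : v = a
        · subst hv
          simp [hfixa τ]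
        · have : Equiv.Perm.ofSubtype τ v ≠ a := fun h3 =>
            hv ((Equiv.Perm.ofSubtype τ).injective (h3.trans (hfixa τ).symm))
          simp [hv, this]
      simp only [hf, h2]
      rw [← ENNReal.ofReal_natCast T.card.factorial, ← ENNReal.ofReal_mul (by positivity)]
      refine le_trans (le_of_eq ?_) (ENNReal.ofReal_le_ofReal h1)
      rw [ENNReal.ofReal_sum_of_nonneg fun _ _ => by positivity]
      simp
    · intro v hv
      have hva : v ≠ a := fun h3 => haT (h3 ▸ hv)
      simpa [hva] using (hρE v hva).1 hv
    · intro v hv hva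
      have h3 : ¬ lam < ρ v := fun h3 => hv ((hρE v hva).2 h3)
      simpa [hva] using lt_of_le_of_ne (not_lt.1 h3) (hρn v)
    · intro u hu v hv huv
      have hua : u ≠ a := fun h3 => haT (h3 ▸ hu)
      have hva : v ≠ a := fun h3 => haT (h3 ▸ hv)
      rw [Function.update_of_ne hua, Function.update_of_ne hva] at huv
      exact hρi huv
  have h0 : (T.card.factorial : ℝ≥0∞) ≠ 0 := by
    exact_mod_cast T.card.factorial_ne_zero
  have h1 : (T.card.factorial : ℝ≥0∞) ≠ ∞ := ENNReal.natCast_ne_top _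
  rw [← ENNReal.mul_le_mul_iff_right h0 h1, hsum, ← lintegral_const_mul' _ _ h1]
  exact lintegral_mono_ae hbound

theorem IsEdgeUpdate.lintegral_pin_le (h : IsEdgeUpdate G G' a b) (hab : a ≠ b) {lam : ℝ}
    (hlam : lam ∈ Set.Icc (0 : ℝ) 1) :
    ∫⁻ ρ, ((affected G G' (pin a b lam ρ)).card : ℝ≥0∞) ∂rankLaw V ≤
      ENNReal.ofReal (1 + Real.log (Fintype.card V)) := by
  classical
  rcases hlam.2.eq_or_lt with rfl | hlt
  -- At `lam = 1` the event that `b` lies above `lam` is null. Instead, `a` and `b` tie as the last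
  -- vertices almost surely, and the identifiers decide which goes first.
  · have hae : ∀ᵐ ρ ∂rankLaw V, ((affected G G' (pin a b 1 ρ)).card : ℝ≥0∞) ≤
        ENNReal.ofReal (1 + Real.log (Fintype.card V)) := by
      have h1 : ∀ᵐ ρ ∂rankLaw V, ∀ v, ρ v ∈ Set.Icc (0 : ℝ) 1 :=
        ae_all_iff.2 fun v => ae_rankLaw_eval v ae_unif_mem
      have h2 : ∀ᵐ ρ ∂rankLaw V, ∀ v, ρ v ≠ 1 := ae_all_iff.2 fun v => ae_rankLaw_ne v 1
      filter_upwards [h1, h2] with ρ hρ1 hρ2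
      have ea : pin a b 1 ρ a = 1 := by simp [pin, hab]
      have eb : pin a b 1 ρ b = 1 := by simp [pin]
      have ev : ∀ v, v ≠ a → v ≠ b → pin a b 1 ρ v < 1 := by
        intro v hva hvb
        simpa [pin, hva, hvb] using (hρ1 v).2.lt_of_ne (hρ2 v)
      rw [← ENNReal.ofReal_natCast]
      apply ENNReal.ofReal_le_ofReal
      rcases lt_or_gt_of_ne hab with hlt | hlt
      · refine h.card_affected_le (key_lt_iff.2 (Or.inr ⟨ea.trans eb.symm, hlt⟩)) fun v h1 h2 => ?_
        exact key_lt_iff.2 (Or.inl ((ev v h1 h2).trans_eq ea.symm))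
      · refine h.swap.card_affected_le (key_lt_iff.2 (Or.inr ⟨eb.trans ea.symm, hlt⟩))
          fun v h1 h2 => ?_
        exact key_lt_iff.2 (Or.inl ((ev v h2 h1).trans_eq eb.symm))
    refine (lintegral_mono_ae hae).trans ?_
    simp
  set K := ENNReal.ofReal (1 + Real.log (Fintype.card V)) with hK
  have hpos : ENNReal.ofReal (1 - lam) ≠ 0 := by simpa using hlt
  -- Multiplying by the probability that `b` lies above `lam` makes `b` exchangeable with the other
  -- vertices above `lam`.
  rw [← ENNReal.mul_le_mul_iff_right hpos ENNReal.ofReal_ne_top,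
    mul_lintegral_pin hab hlam (measurable_card_affected G G')]
  have hconst := mul_lintegral_pin hab hlam (F := fun _ : V → ℝ => K) measurable_const
  rw [lintegral_const, measure_univ, mul_one] at hconst
  rw [hconst]
  set S := {ρ : V → ℝ | lam < ρ b} with hS
  have hSm : MeasurableSet S := measurableSet_lt (by fun_prop) (by fun_prop)
  -- Partition the space by the set of vertices above `lam`; only the classes containing `b`
  -- contribute.
  set U : (V → ℝ) → Finset V := fun ρ => Finset.univ.filter fun v => v ≠ a ∧ lam < ρ v with hU
  have hUE : ∀ T : Finset V, a ∉ T →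
      U ⁻¹' {T} = {ρ : V → ℝ | ∀ v, v ≠ a → (v ∈ T ↔ lam < ρ v)} := by
    intro T haT
    ext ρ
    simp only [Set.mem_preimage, Set.mem_singleton_iff, Finset.ext_iff, hU, Finset.mem_filter,
      Finset.mem_univ, true_and, Set.mem_ofPred_eq]
    refine forall_congr' fun v => ?_
    by_cases hv : v = a
    · subst hv
      simp [haT]
    · simp [hv, iff_comm]
  have hUm : Measurable[_, ⊤] U := by
    refine @measurable_to_countable' _ _ ⊤ _ _ _ fun T => ?_
    have : U ⁻¹' {T} = ⋂ v, {ρ : V → ℝ | (v ≠ a ∧ lam < ρ v) ↔ v ∈ T} := by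
      ext ρ
      simp [hU, Finset.ext_iff]
    rw [this]
    refine MeasurableSet.iInter fun v => ?_
    have hm : MeasurableSet {ρ : V → ℝ | lam < ρ v} :=
      measurableSet_lt (by fun_prop) (by fun_prop)
    by_cases h1 : v = a
    · simp [h1]
    · by_cases h2 : v ∈ T
      · simpa [h1, h2] using hm
      · convert hm.compl using 1
        ext ρ
        simp [h1, h2]
  have hUs : ∀ T, MeasurableSet (U ⁻¹' {T}) := fun T => hUm trivial
  have hsplit : ∀ g : (V → ℝ) → ℝ≥0∞,
      ∫⁻ ρ, g ρ ∂rankLaw V = ∑ T, ∫⁻ ρ in U ⁻¹' {T}, g ρ ∂rankLaw V := by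
    intro g
    rw [← tsum_fintype (L := .unconditional _), ← lintegral_iUnion hUs]
    · have : ⋃ T, U ⁻¹' {T} = Set.univ := by
        ext ρ
        simp
      rw [this, Measure.restrict_univ]
    · intro T T' hne
      exact Disjoint.preimage _ (by simpa using hne)
  rw [hsplit, hsplit]
  refine Finset.sum_le_sum fun T _ => ?_
  by_cases haT : a ∈ T
  · have : U ⁻¹' {T} = ∅ := by
      ext ρ
      simp only [Set.mem_preimage, Set.mem_singleton_iff, Set.mem_empty_iff_false, iff_false]
      rintro rfl
      simp [hU] at haT
    simp [this]
  by_cases hbT : b ∈ T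
  · have hsub : U ⁻¹' {T} ⊆ S := by
      intro ρ hρ
      have : b ∈ U ρ := by
        rw [show U ρ = T from hρ]
        exact hbT
      simp only [hU, Finset.mem_filter] at this
      exact this.2.2
    have hind : ∀ g : (V → ℝ) → ℝ≥0∞, ∫⁻ ρ in U ⁻¹' {T}, S.indicator g ρ ∂rankLaw V =
        ∫⁻ ρ in U ⁻¹' {T}, g ρ ∂rankLaw V := fun g =>
      setLIntegral_congr_fun (hUs T) fun ρ hρ => Set.indicator_of_mem (hsub hρ) g
    rw [hind, hind, hUE T haT]
    exact h.lintegral_upper_le hab lam haT hbT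
  · have hind : ∫⁻ ρ in U ⁻¹' {T}, S.indicator
        (fun ρ => ((affected G G' (Function.update ρ a lam)).card : ℝ≥0∞)) ρ ∂rankLaw V = 0 := by
      rw [setLIntegral_congr_fun (g := fun _ => 0) (hUs T), lintegral_zero]
      intro ρ hρ
      refine Set.indicator_of_notMem (fun hρS => hbT ?_) _
      rw [← show U ρ = T from hρ]
      simp only [hU, Finset.mem_filter, Finset.mem_univ, true_and]
      exact ⟨hab.symm, hρS⟩
    rw [hind]
    exact zero_le

theorem IsEdgeUpdate.lintegral_condRankLaw_le (h : IsEdgeUpdate G G' a b) (hab : a ≠ b) {lam : ℝ}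
    (hlam : lam ∈ Set.Icc (0 : ℝ) 1) :
    ∫⁻ π, ((affected G G' π).card : ℝ≥0∞) ∂condRankLaw a b lam ≤
      ENNReal.ofReal (1 + Real.log (Fintype.card V)) := by
  rw [lintegral_condRankLaw a b lam _ (measurable_card_affected G G')]
  calc _ ≤ (2⁻¹ : ℝ≥0∞) * ENNReal.ofReal (1 + Real.log (Fintype.card V)) +
        2⁻¹ * ENNReal.ofReal (1 + Real.log (Fintype.card V)) := by
        gcongr
        · exact h.lintegral_pin_le hab hlam
        · exact h.swap.lintegral_pin_le hab.symm hlam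
    _ = _ := by rw [← add_mul, ENNReal.inv_two_add_inv_two, one_mul]

end RealRanks

/-! ### Ranks uniform among the `k`-bit fractions -/

section GridRanks

variable {V : Type*} {k : ℕ}

theorem gridRank_lt {σ : V → Fin (2 ^ k)} {u v : V} :
    gridRank σ u < gridRank σ v ↔ σ u < σ v := by
  unfold gridRank
  rw [div_lt_div_iff_of_pos_right (by positivity), Nat.cast_lt, Fin.lt_def]

theorem gridRank_eq {σ σ' : V → Fin (2 ^ k)} {u v : V} :
    gridRank σ u = gridRank σ' v ↔ σ u = σ' v := by
  unfold gridRank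
  rw [div_left_inj' (by positivity), Nat.cast_inj, Fin.ext_iff]

theorem gridRank_le {σ : V → Fin (2 ^ k)} {u v : V} :
    gridRank σ u ≤ gridRank σ v ↔ σ u ≤ σ v := by
  rw [← not_lt, gridRank_lt, not_lt]

variable [Fintype V]

open scoped Classical in
/-- The `k`-bit rankings with `min (π a) (π b) = lam`. -/
def gridEvent (k : ℕ) (a b : V) (lam : ℝ) : Finset (V → Fin (2 ^ k)) :=
  Finset.univ.filter fun σ => min (gridRank σ a) (gridRank σ b) = lam

theorem mem_gridEvent {a b : V} {lam : ℝ} {σ : V → Fin (2 ^ k)} :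
    σ ∈ gridEvent k a b lam ↔ min (gridRank σ a) (gridRank σ b) = lam := by
  simp [gridEvent]

theorem gridEvent_comm (a b : V) (lam : ℝ) : gridEvent k a b lam = gridEvent k b a lam := by
  ext σ
  rw [mem_gridEvent, mem_gridEvent, min_comm]

variable [LinearOrder V]

/-- A tie that involves a vertex other than `a` and `b` has probability at most `1 / 2 ^ k`. -/
theorem card_tie_mul_le {a b u v : V} (lam : ℝ) (hua : u ≠ a) (hub : u ≠ b) (huv : u ≠ v) :
    ((gridEvent k a b lam).filter fun σ => σ u = σ v).card * 2 ^ k ≤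
      (gridEvent k a b lam).card := by
  have h1 : ((gridEvent k a b lam).filter fun σ => σ u = σ v).card * 2 ^ k =
      (((gridEvent k a b lam).filter fun σ => σ u = σ v) ×ˢ
        (Finset.univ : Finset (Fin (2 ^ k)))).card := by simp
  rw [h1]
  -- Resample the rank of `u`: the event does not involve it, and the old value is recovered as that
  -- of `v`.
  refine Finset.card_le_card_of_injOn (fun p => Function.update p.1 u p.2) ?_ ?_
  · rintro ⟨σ, x⟩ hσ
    simp only [Finset.coe_product, Set.mem_prod, Finset.mem_coe, Finset.mem_filter,
      mem_gridEvent] at hσ ⊢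
    have : ∀ w, u ≠ w → gridRank (Function.update σ u x) w = gridRank σ w := fun w hw =>
      gridRank_eq.2 (Function.update_of_ne hw.symm _ _)
    rw [this a hua, this b hub]
    exact hσ.1.1
  · rintro ⟨σ, x⟩ hσ ⟨σ', x'⟩ hσ' h
    simp only [Finset.coe_product, Set.mem_prod, Finset.mem_coe, Finset.mem_filter] at hσ hσ'
    have h2 : ∀ w, w ≠ u → σ w = σ' w := fun w hw => by
      simpa [Function.update_of_ne hw] using congrFun h w
    have h3 : x = x' := by simpa using congrFun h u
    refine Prod.ext (funext fun w => ?_) h3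
    by_cases hw : w = u
    · subst hw
      change σ w = σ' w
      rw [hσ.1.2, hσ'.1.2, h2 v huv.symm]
    · exact h2 w hw

/-- Swapping the ranks of `b` and `u` turns a tie of `a` and `b` below `u` into a tie of `u` and
`a`, without changing the minimum. -/
theorem card_over_le {a b u : V} (lam : ℝ) (hab : a ≠ b) (hua : u ≠ a) :
    ((gridEvent k a b lam).filter fun σ => σ a = σ b ∧ σ a < σ u).card ≤
      ((gridEvent k a b lam).filter fun σ => σ u = σ a).card := by
  refine Finset.card_le_card_of_injOn (fun σ => σ ∘ Equiv.swap b u) ?_ ?_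
  · intro σ hσ
    simp only [Finset.mem_coe, Finset.mem_filter, mem_gridEvent] at hσ ⊢
    obtain ⟨h1, h2, h3⟩ := hσ
    have ea : Equiv.swap b u a = a := Equiv.swap_apply_of_ne_of_ne hab hua.symm
    have e1 : gridRank (σ ∘ Equiv.swap b u) a = gridRank σ a := by
      rw [gridRank_eq, Function.comp_apply, ea]
    have e2 : gridRank (σ ∘ Equiv.swap b u) b = gridRank σ u := by
      rw [gridRank_eq, Function.comp_apply, Equiv.swap_apply_left]
    refine ⟨?_, ?_⟩
    · rw [e1, e2, min_eq_left (gridRank_le.2 h3.le)]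
      rwa [gridRank_eq.2 h2.symm, min_self] at h1
    · rw [Function.comp_apply, Function.comp_apply, Equiv.swap_apply_right, ea, h2]
  · intro σ _ σ' _ h
    exact (Equiv.surjective (Equiv.swap b u)).injective_comp_right h

variable {G G' : SimpleGraph V} {a b : V}

theorem card_affected_le_card (G G' : SimpleGraph V) (π : V → ℝ) :
    ((affected G G' π).card : ℝ) ≤ Fintype.card V := by
  exact_mod_cast Finset.card_le_univ _

/-- The counting version of the exchangeability argument: permutations of `T` act on the injective
rankings with `T` as the set above `a`. -/
theorem IsEdgeUpdate.sum_grid_upper_le (h : IsEdgeUpdate G G' a b) (hab : a ≠ b) (lam : ℝ)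
    {T : Finset V} (hbT : b ∈ T) (S : Finset (V → Fin (2 ^ k)))
    (hS : ∀ σ, σ ∈ S ↔ gridRank σ a = lam ∧ Function.Injective σ ∧ ∀ v, v ∈ T ↔ σ a < σ v) :
    ∑ σ ∈ S, ((affected G G' (gridRank σ)).card : ℝ) ≤
      S.card * (1 + Real.log (Fintype.card V)) := by
  classical
  rcases S.eq_empty_or_nonempty with rfl | ⟨σ₀, hσ₀⟩
  · simp
  have haT : a ∉ T := fun h1 => lt_irrefl _ ((((hS σ₀).1 hσ₀).2.2 a).1 h1)
  have hmemT : ∀ (τ : Equiv.Perm {v // v ∈ T}) (v : V),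
      Equiv.Perm.ofSubtype τ v ∈ T ↔ v ∈ T := by
    intro τ v
    by_cases hv : v ∈ T
    · rw [Equiv.Perm.ofSubtype_apply_of_mem τ hv]
      simp [hv]
    · rw [Equiv.Perm.ofSubtype_apply_of_not_mem τ hv]
  have hfixa : ∀ τ : Equiv.Perm {v // v ∈ T}, Equiv.Perm.ofSubtype τ a = a :=
    fun τ => Equiv.Perm.ofSubtype_apply_of_not_mem τ haT
  have hmemS : ∀ (τ : Equiv.Perm {v // v ∈ T}) σ, σ ∈ S → σ ∘ Equiv.Perm.ofSubtype τ ∈ S := by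
    intro τ σ hσ
    rw [hS] at hσ ⊢
    refine ⟨?_, hσ.2.1.comp (Equiv.injective _), fun v => ?_⟩
    · rw [← hσ.1, gridRank_eq, Function.comp_apply, hfixa]
    · rw [Function.comp_apply, Function.comp_apply, hfixa, ← hσ.2.2, hmemT]
  have hinv : ∀ τ : Equiv.Perm {v // v ∈ T},
      ∑ σ ∈ S, ((affected G G' (gridRank σ ∘ Equiv.Perm.ofSubtype τ)).card : ℝ) =
        ∑ σ ∈ S, ((affected G G' (gridRank σ)).card : ℝ) := by
    intro τ
    refine Finset.sum_bij' (fun σ _ => σ ∘ Equiv.Perm.ofSubtype τ)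
      (fun σ _ => σ ∘ Equiv.Perm.ofSubtype τ⁻¹) (fun σ hσ => hmemS τ σ hσ)
      (fun σ hσ => hmemS τ⁻¹ σ hσ) ?_ ?_ ?_
    · intro σ _
      ext v
      simp
    · intro σ _
      ext v
      simp
    · intro σ _
      rfl
  have hcard : Fintype.card (Equiv.Perm {v // v ∈ T}) = T.card.factorial := by
    rw [Fintype.card_perm, Fintype.card_coe]
  have hpos : (0 : ℝ) < T.card.factorial := by exact_mod_cast T.card.factorial_pos
  rw [← mul_le_mul_iff_right₀ hpos]
  calc _ = ∑ τ : Equiv.Perm {v // v ∈ T},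
        ∑ σ ∈ S, ((affected G G' (gridRank σ ∘ Equiv.Perm.ofSubtype τ)).card : ℝ) := by
        simp only [hinv, Finset.sum_const, nsmul_eq_mul, Finset.card_univ, hcard]
    _ = ∑ σ ∈ S, ∑ τ : Equiv.Perm {v // v ∈ T},
        ((affected G G' (gridRank σ ∘ Equiv.Perm.ofSubtype τ)).card : ℝ) := Finset.sum_comm
    _ ≤ ∑ σ ∈ S, T.card.factorial * (1 + Real.log (Fintype.card V)) := by
        refine Finset.sum_le_sum fun σ hσ => ?_
        obtain ⟨_, hi, hT⟩ := (hS σ).1 hσ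
        refine h.sum_perm_le hab hbT (fun v hv => gridRank_lt.2 ((hT v).1 hv)) ?_ ?_
        · intro v hv hva
          rw [gridRank_lt]
          exact lt_of_le_of_ne (not_lt.1 fun h1 => hv ((hT v).2 h1)) (hi.ne hva)
        · exact fun u _ v _ huv => hi (gridRank_eq.1 huv)
    _ = _ := by
        rw [Finset.sum_const, nsmul_eq_mul]
        ring

theorem IsEdgeUpdate.sum_grid_injective_le (h : IsEdgeUpdate G G' a b) (hab : a ≠ b) (lam : ℝ)
    (S : Finset (V → Fin (2 ^ k)))
    (hS : ∀ σ, σ ∈ S ↔ σ ∈ gridEvent k a b lam ∧ σ a < σ b ∧ Function.Injective σ) :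
    ∑ σ ∈ S, ((affected G G' (gridRank σ)).card : ℝ) ≤
      S.card * (1 + Real.log (Fintype.card V)) := by
  classical
  set U : (V → Fin (2 ^ k)) → Finset V := fun σ => Finset.univ.filter fun v => σ a < σ v with hU
  rw [← Finset.sum_fiberwise S U, Finset.card_eq_sum_card_fiberwise (f := U) (t := Finset.univ)
    fun _ _ => Finset.mem_coe.2 (Finset.mem_univ _)]
  push_cast
  rw [Finset.sum_mul]
  refine Finset.sum_le_sum fun T _ => ?_
  by_cases hbT : b ∈ T
  · refine h.sum_grid_upper_le hab lam hbT _ fun σ => ?_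
    have hUT : U σ = T ↔ ∀ v, v ∈ T ↔ σ a < σ v := by
      rw [Finset.ext_iff]
      refine forall_congr' fun v => ?_
      simp only [hU, Finset.mem_filter, Finset.mem_univ, true_and]
      exact iff_comm
    rw [Finset.mem_filter, hS, mem_gridEvent, hUT]
    constructor
    · rintro ⟨⟨h1, h2, h3⟩, h4⟩
      rw [min_eq_left (gridRank_le.2 h2.le)] at h1
      exact ⟨h1, h3, h4⟩
    · rintro ⟨h1, h3, h4⟩
      have h2 := (h4 b).1 hbT
      refine ⟨⟨?_, h2, h3⟩, h4⟩
      rwa [min_eq_left (gridRank_le.2 h2.le)]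
  · have : S.filter (fun σ => U σ = T) = ∅ := by
      rw [Finset.filter_eq_empty_iff]
      rintro σ hσ rfl
      have h1 := ((hS σ).1 hσ).2.1
      simp [hU, h1] at hbT
    simp [this]

open scoped Classical in
/-- The rankings that have a tie other than that of `a` and `b`, or in which `a` and `b` tie below
another vertex. -/
def gridBad (k : ℕ) (a b : V) (lam : ℝ) : Finset (V → Fin (2 ^ k)) :=
  Finset.univ.biUnion fun p : V × V => (gridEvent k a b lam).filter fun σ =>
    p.1 ≠ a ∧ p.1 ≠ b ∧ (p.1 ≠ p.2 ∧ σ p.1 = σ p.2 ∨ p.1 = p.2 ∧ σ a = σ b ∧ σ a < σ p.1)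

theorem mem_gridBad {lam : ℝ} {σ : V → Fin (2 ^ k)} (hσ : σ ∈ gridEvent k a b lam) {u v : V}
    (hua : u ≠ a) (hub : u ≠ b) (h : u ≠ v ∧ σ u = σ v ∨ u = v ∧ σ a = σ b ∧ σ a < σ u) :
    σ ∈ gridBad k a b lam := by
  unfold gridBad
  rw [Finset.mem_biUnion]
  exact ⟨(u, v), Finset.mem_univ _, Finset.mem_filter.2 ⟨hσ, hua, hub, h⟩⟩

/-- Union bound over `n ^ 2` pairs. The diagonal pairs encode a tie of `a` and `b` below `u`, which
is no more likely than a tie of `u` with `a`. -/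
theorem card_gridBad_mul_le (hab : a ≠ b) (lam : ℝ) :
    (gridBad k a b lam).card * 2 ^ k ≤ Fintype.card V ^ 2 * (gridEvent k a b lam).card := by
  classical
  refine (Nat.mul_le_mul_right _ Finset.card_biUnion_le).trans ?_
  rw [Finset.sum_mul]
  have : Fintype.card V ^ 2 * (gridEvent k a b lam).card =
      ∑ _ : V × V, (gridEvent k a b lam).card := by
    simp [Fintype.card_prod, sq]
  rw [this]
  refine Finset.sum_le_sum fun p _ => ?_
  obtain ⟨u, v⟩ := p
  by_cases hu : u ≠ a ∧ u ≠ b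
  · by_cases huv : u = v
    · subst huv
      refine le_trans (Nat.mul_le_mul_right _ ?_) (card_tie_mul_le lam hu.1 hu.2 hu.1)
      refine le_trans (Finset.card_le_card ?_) (card_over_le lam hab hu.1)
      refine Finset.monotone_filter_right _ fun σ _ hσ => ?_
      tauto
    · refine le_trans (Nat.mul_le_mul_right _ (Finset.card_le_card ?_))
        (card_tie_mul_le lam hu.1 hu.2 huv)
      refine Finset.monotone_filter_right _ fun σ _ hσ => ?_
      tauto
  · have : (gridEvent k a b lam).filter (fun σ => u ≠ a ∧ u ≠ b ∧
        (u ≠ v ∧ σ u = σ v ∨ u = v ∧ σ a = σ b ∧ σ a < σ u)) = ∅ :=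
      Finset.filter_false_of_mem fun σ _ hσ => hu ⟨hσ.1, hσ.2.1⟩
    rw [this]
    simp

/-- Rankings that are not bad either have no ties, or `a` and `b` are the last vertices. -/
theorem IsEdgeUpdate.card_affected_grid_le (h : IsEdgeUpdate G G' a b) (hab : a ≠ b) {lam : ℝ}
    {σ : V → Fin (2 ^ k)} (hσ : σ ∈ gridEvent k a b lam)
    (h1 : ¬ (σ a < σ b ∧ Function.Injective σ)) (h2 : ¬ (σ b < σ a ∧ Function.Injective σ))
    (hbad : σ ∉ gridBad k a b lam) :
    ((affected G G' (gridRank σ)).card : ℝ) ≤ 1 + Real.log (Fintype.card V) := by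
  classical
  have htie : ∀ u v, u ≠ a → u ≠ b → u ≠ v → σ u ≠ σ v := fun u v hua hub huv h3 =>
    hbad (mem_gridBad hσ hua hub (Or.inl ⟨huv, h3⟩))
  have hover : ∀ u, u ≠ a → u ≠ b → σ a = σ b → ¬ σ a < σ u := fun u hua hub h3 h4 =>
    hbad (mem_gridBad hσ hua hub (Or.inr ⟨rfl, h3, h4⟩))
  have heq : σ a = σ b := by
    by_contra hne
    have hinj : Function.Injective σ := by
      intro u v huv
      by_contra hne'
      by_cases hu : u = a ∨ u = b
      · by_cases hv : v = a ∨ v = b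
        · rcases hu with rfl | rfl <;> rcases hv with rfl | rfl
          · exact hne' rfl
          · exact hne huv
          · exact hne huv.symm
          · exact hne' rfl
        · rw [not_or] at hv
          exact htie v u hv.1 hv.2 (Ne.symm hne') huv.symm
      · rw [not_or] at hu
        exact htie u v hu.1 hu.2 hne' huv
    rcases lt_or_gt_of_ne hne with h3 | h3
    · exact h1 ⟨h3, hinj⟩
    · exact h2 ⟨h3, hinj⟩
  have hlt : ∀ v, v ≠ a → v ≠ b → gridRank σ v < gridRank σ a := fun v hva hvb =>
    gridRank_lt.2 (lt_of_le_of_ne (not_lt.1 (hover v hva hvb heq)) (htie v a hva hvb hva))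
  rcases lt_or_gt_of_ne hab with hlt' | hlt'
  · exact h.card_affected_le (key_lt_iff.2 (Or.inr ⟨gridRank_eq.2 heq, hlt'⟩)) fun v hva hvb =>
      key_lt_iff.2 (Or.inl (hlt v hva hvb))
  · exact h.swap.card_affected_le (key_lt_iff.2 (Or.inr ⟨gridRank_eq.2 heq.symm, hlt'⟩))
      fun v hvb hva => key_lt_iff.2 (Or.inl (gridRank_eq.2 heq ▸ hlt v hva hvb))

/-- Split into injective rankings with `a` first, those with `b` first, and the rest. Bad rankings
add at most `n * n ^ 2 / 2 ^ k ≤ 1` to `1 + log n`, whence the cube in the hypothesis. -/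
theorem IsEdgeUpdate.gridCondExp_le (h : IsEdgeUpdate G G' a b) (hab : a ≠ b) (lam : ℝ)
    (hk : (Fintype.card V : ℝ) ^ 3 ≤ 2 ^ k) :
    gridCondExp k a b lam (fun π => ((affected G G' π).card : ℝ)) ≤
      2 + Real.log (Fintype.card V) := by
  classical
  have hlog : 0 ≤ Real.log (Fintype.card V) := Real.log_natCast_nonneg _
  have hexp : gridCondExp k a b lam (fun π => ((affected G G' π).card : ℝ)) =
      (∑ σ ∈ gridEvent k a b lam, ((affected G G' (gridRank σ)).card : ℝ)) /
        (gridEvent k a b lam).card := Finset.expect_eq_sum_div_card _ _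
  rw [hexp]
  -- This also covers an unattainable `lam`, where the event is empty and the average is `0`.
  refine div_le_of_le_mul₀ (by positivity) (by positivity) ?_
  set Ω := gridEvent k a b lam with hΩ
  set K := 1 + Real.log (Fintype.card V) with hK
  set X : (V → Fin (2 ^ k)) → ℝ := fun σ => ((affected G G' (gridRank σ)).card : ℝ) with hX
  have hbad : (Fintype.card V : ℝ) * (gridBad k a b lam).card ≤ Ω.card := by
    have h1 : ((gridBad k a b lam).card : ℝ) * 2 ^ k ≤ Fintype.card V ^ 2 * Ω.card := by
      exact_mod_cast card_gridBad_mul_le (k := k) hab lam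
    have h2 : (0 : ℝ) < 2 ^ k := by positivity
    rw [← mul_le_mul_iff_left₀ h2]
    calc (Fintype.card V : ℝ) * (gridBad k a b lam).card * 2 ^ k
        = Fintype.card V * ((gridBad k a b lam).card * 2 ^ k) := by ring
      _ ≤ Fintype.card V * (Fintype.card V ^ 2 * Ω.card) := by gcongr
      _ = Fintype.card V ^ 3 * Ω.card := by ring
      _ ≤ 2 ^ k * Ω.card := by gcongr
      _ = Ω.card * 2 ^ k := by ring
  set p : (V → Fin (2 ^ k)) → Prop := fun σ => σ a < σ b ∧ Function.Injective σ with hp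
  set q : (V → Fin (2 ^ k)) → Prop := fun σ => σ b < σ a ∧ Function.Injective σ with hq
  have e1 : ∑ σ ∈ Ω.filter p, X σ ≤ (Ω.filter p).card * K :=
    h.sum_grid_injective_le hab lam _ fun σ => by rw [Finset.mem_filter]
  have e2 : ∑ σ ∈ (Ω.filter fun σ => ¬ p σ).filter q, X σ ≤
      ((Ω.filter fun σ => ¬ p σ).filter q).card * K := by
    refine h.swap.sum_grid_injective_le hab.symm lam _ fun σ => ?_
    rw [Finset.mem_filter, Finset.mem_filter, hΩ, gridEvent_comm]
    constructor
    · exact fun h1 => ⟨h1.1.1, h1.2⟩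
    · exact fun h1 => ⟨⟨h1.1, fun h2 => h2.1.not_gt h1.2.1⟩, h1.2⟩
  set R := (Ω.filter fun σ => ¬ p σ).filter fun σ => ¬ q σ with hR
  have e3 : ∑ σ ∈ R, X σ ≤ R.card * K + Fintype.card V * (gridBad k a b lam).card := by
    have h1 : ∀ σ ∈ R, X σ ≤ K + if σ ∈ gridBad k a b lam then (Fintype.card V : ℝ) else 0 := by
      intro σ hσ
      simp only [hR, Finset.mem_filter] at hσ
      split_ifs with h2
      · have := card_affected_le_card G G' (gridRank σ)
        simp only [hX, hK]
        linarith
      · rw [add_zero]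
        exact h.card_affected_grid_le hab hσ.1.1 hσ.1.2 hσ.2 h2
    refine (Finset.sum_le_sum h1).trans ?_
    rw [Finset.sum_add_distrib, Finset.sum_const, nsmul_eq_mul, ← Finset.sum_filter,
      Finset.sum_const, nsmul_eq_mul, mul_comm (Fintype.card V : ℝ)]
    gcongr
    intro σ hσ
    exact (Finset.mem_filter.1 hσ).2
  have s1 := Finset.sum_filter_add_sum_filter_not Ω p X
  have s2 := Finset.sum_filter_add_sum_filter_not (Ω.filter fun σ => ¬ p σ) q X
  have c1 : ((Ω.filter p).card : ℝ) + (Ω.filter fun σ => ¬ p σ).card = Ω.card := by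
    exact_mod_cast Finset.card_filter_add_card_filter_not (s := Ω) p
  have c2 : (((Ω.filter fun σ => ¬ p σ).filter q).card : ℝ) + R.card =
      (Ω.filter fun σ => ¬ p σ).card := by
    exact_mod_cast Finset.card_filter_add_card_filter_not (s := Ω.filter fun σ => ¬ p σ) q
  calc _ = ∑ σ ∈ Ω.filter p, X σ + (∑ σ ∈ (Ω.filter fun σ => ¬ p σ).filter q, X σ +
        ∑ σ ∈ R, X σ) := by rw [s2, s1]
    _ ≤ (Ω.filter p).card * K + (((Ω.filter fun σ => ¬ p σ).filter q).card * K +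
        (R.card * K + Ω.card)) := by gcongr; exact e3.trans (by gcongr)
    _ = (((Ω.filter p).card : ℝ) + (((Ω.filter fun σ => ¬ p σ).filter q).card + R.card)) * K +
        Ω.card := by ring
    _ = (2 + Real.log (Fintype.card V)) * Ω.card := by
        rw [c2, c1, hK]
        ring

end GridRanks

end RandomGreedyMIS

end

/-! ### The two models with explicit constants -/

theorem mainTheorem3 :
    ∃ C c : ℝ, ∀ (V : Type*) [Fintype V] [LinearOrder V] (G G' : SimpleGraph V) (a b : V),
      a ≠ b → RandomGreedyMIS.IsEdgeUpdate G G' a b →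
        -- ranks uniform in `[0, 1]`
        (∀ lam ∈ Set.Icc (0 : ℝ) 1,
          ∫⁻ π, ((RandomGreedyMIS.affected G G' π).card : ℝ≥0∞)
              ∂(RandomGreedyMIS.condRankLaw a b lam) ≤
            ENNReal.ofReal (C * Real.log (Fintype.card V))) ∧
        -- ranks uniform among the `k`-bit fractions, for `k` at least `c` times `log n`
        (∀ k : ℕ, c * Real.logb 2 (Fintype.card V) ≤ k → ∀ lam ∈ Set.Icc (0 : ℝ) 1,
          RandomGreedyMIS.gridCondExp k a b lam
              (fun π => ((RandomGreedyMIS.affected G G' π).card : ℝ)) ≤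
            C * Real.log (Fintype.card V)) := by
  -- `c = 3` gives `n ^ 3 ≤ 2 ^ k`. Since `n ≥ 2` and `3 * log 2 > 2`, the additive constant `2` is
  -- absorbed into `3 * log n`, so `C = 4`.
  refine ⟨4, 3, fun V _ _ G G' a b hab h => ?_⟩
  have hn : (2 : ℝ) ≤ Fintype.card V := by
    exact_mod_cast Fintype.one_lt_card_iff.2 ⟨a, b, hab⟩
  have hlog : 2 ≤ 3 * Real.log (Fintype.card V) := by
    have h1 := Real.log_le_log (by norm_num) hn
    have h2 := Real.log_two_gt_d9
    linarith
  refine ⟨fun lam hlam => (h.lintegral_condRankLaw_le hab hlam).trans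
    (ENNReal.ofReal_le_ofReal (by linarith)), fun k hk lam _ => ?_⟩
  refine (h.gridCondExp_le hab lam ?_).trans (by linarith)
  have hpos : (0 : ℝ) < Fintype.card V := by linarith
  have h1 : Real.logb 2 ((Fintype.card V : ℝ) ^ 3) ≤ k := by
    rw [Real.logb_pow]
    exact_mod_cast hk
  rw [Real.logb_le_iff_le_rpow (by norm_num) (by positivity)] at h1
  exact_mod_cast h1
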